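/- **Economy.** Let $\ell\ge 1$. Let $(\Omega,\mathscr F,\mathbb P)$ be a complete probability space (states of nature) and $(T,\Sigma,\mu)$ a complete finite measure space (agents), written $T=T_0\cup T_1$, where $T_0$ is atomless and $T_1$ is the union of a countable (possibly empty) family $\mathscr A$ of pairwise disjoint $\mu$-atoms, the large agents. Each agent $t$ has an information partition $\Pi_t$ of $\Omega$, a utility $U(t,\omega,\cdot):\mathbb R^\ell_+\to\mathbb R$ and an endowment $a(t,\omega)\in\mathbb R^\ell_+$ in each state $\omega$, and a prior $\mathbb P_t$, a probability measure on $\mathscr F$. Every $\Pi_t$ is one of finitely many partitions $\mathscr Q_1,\dots,\mathscr Q_n$ of $\Omega$ into sets of $\mathscr F$; $\mathscr F_t$ is the $\sigma$-algebra generated by $\Pi_t$. For $S\in\Sigma$ put $S^i=\{t\in S:\Pi_t=\mathscr Q_i\}$ (with $T^i\in\Sigma$) and $\mathfrak P(S)=\{i:\mu(S^i)>0\}$; $\bigvee_{i\in I}\mathscr Q_i$ is the $\sigma$-algebra generated by the common refinement of the $\mathscr Q_i$, $i\in I$. **Assumptions.** - $a$ is $\Sigma\otimes\mathscr F$-measurable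 and, for every $\omega$, $a(\cdot,\omega)$ is integrable with all coordinates strictly positive $\mu$-a.e. - $U(\cdot,\cdot,x)$ is $\Sigma\otimes\mathscr F$-measurable for every $x\in\mathbb R^\ell_+$, and every $U(t,\omega,\cdot)$ is continuous and strictly increasing ($x\le y$, $x\ne y$ implies $U(t,\omega,x)<U(t,\omega,y)$). - $U(t,\omega,\cdot)$ is quasi-concave for all $t\in T_1$, $\omega\in\Omega$. - $\mu(T^i)>0$ for all $i$, $T=\bigcup_i T^i$, and $\bigvee_{i=1}^n\mathscr Q_i=\mathscr F$. - All agents in $T_1$ have the same characteristics $(\Pi_t,U(t,\cdot,\cdot),a(t,\cdot),\mathbb P_t)$. - Either $|\mathscr A|\ge 2$ or $\mathscr A=\emptyset$. **Fine core.** An allocation is a function $f:T\times\Omega\to\mathbb R^\ell_+$ with $f(\cdot,\omega)$ integrable and $\int_T f(\cdot,\omega)\,d\mu=\int_T a(\cdot,\omega)\,d\mu$ for every $\omega$, and $f(t,\cdot)$ $\mathscr F$-measurable for every $t$. A coalition is a set $S\in\Sigma$ with $\mu(S)>0$. A communication system for $S$ is a family $\{\mathscr G_t\}_{t\in S}$ of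 $\sigma$-algebras $\mathscr G_t\subseteq\mathscr F$ such that $\{t\in S:\mathscr G_t=\mathscr G\}\in\Sigma$ for every $\sigma$-algebra $\mathscr G\subseteq\mathscr F$, and $\mathscr F_t\subseteq\mathscr G_t\subseteq\bigvee_{i\in\mathfrak P(S)}\mathscr Q_i$ for $\mu$-a.e. $t\in S$. An allocation $f$ is fine blocked by $S$ if there are an allocation $g$, a communication system $\{\mathscr G_t\}_{t\in S}$ for $S$ and a nonempty $\Omega_0\in\bigcap_{t\in S}\mathscr G_t$ such that for all $\omega\in\Omega_0$: $\int_S g(\cdot,\omega)\,d\mu=\int_S a(\cdot,\omega)\,d\mu$, and $\mathbb E_t[U(t,\cdot,g(t,\cdot))\mid\mathscr G_t](\omega)>\mathbb E_t[U(t,\cdot,f(t,\cdot))\mid\mathscr G_t](\omega)$ for $\mu$-a.e. $t\in S$, where $\mathbb E_t$ is expectation under $\mathbb P_t$. Here $\mathbb E_t[u\mid\mathscr G_t]$ has to exist ($u$ integrable on each set of a countable cover of $\Omega$ by sets of $\mathscr G_t$), its versions are taken equal to $u$ everywhere when $u$ is $\mathscr G_t$-measurable, and the inequality has to hold for all such versions.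 The fine core is the set of allocations that no coalition fine blocks. **Claim.** If $f$ is in the fine core, then for every $\omega\in\Omega$ the function $f(\cdot,\omega)$ is a Walrasian equilibrium allocation of the complete-information economy $\mathscr E(\omega)=\{(T,\Sigma,\mu);\mathbb R^\ell_+;(U(t,\omega,\cdot),a(t,\omega))_{t\in T}\}$: there is $p\in\mathbb R^\ell_+$ with $\sum_h p^h=1$ such that for $\mu$-a.e. $t$, $f(t,\omega)$ maximizes $U(t,\omega,\cdot)$ over $\{x\in\mathbb R^\ell_+:\langle p,x\rangle\le\langle p,a(t,\omega)\rangle\}$ (and $\int_T f(\cdot,\omega)\,d\mu=\int_T a(\cdot,\omega)\,d\mu$). -/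

import Mathlib

open MeasureTheory

noncomputable section

namespace MixedEconomy

/-! ### Atoms of a measure -/

/-- `A` is an atom of `μ`. -/
def IsMeasureAtom {T : Type*} [MeasurableSpace T] (μ : Measure T) (A : Set T) : Prop :=
  MeasurableSet A ∧ 0 < μ A ∧ ∀ B ⊆ A, MeasurableSet B → μ B = 0 ∨ μ (A \ B) = 0

/-- `𝒜` is a countable family of pairwise disjoint atoms of `μ`, and there is no atom of `μ`
outside its union. -/
structure IsAtomFamily {T : Type*} [MeasurableSpace T] (μ : Measure T) (𝒜 : Set (Set T)) :
    Prop where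
  countable : 𝒜.Countable
  pairwiseDisjoint : 𝒜.PairwiseDisjoint id
  isAtom : ∀ A ∈ 𝒜, IsMeasureAtom μ A
  atomless_compl : ∀ A ⊆ (⋃₀ 𝒜)ᶜ, ¬ IsMeasureAtom μ A

/-! ### Information partitions -/

/-- A partition of `Ω` into measurable sets. -/
def IsMeasurablePartition {Ω : Type*} [MeasurableSpace Ω] (q : Set (Set Ω)) : Prop :=
  Setoid.IsPartition q ∧ ∀ c ∈ q, MeasurableSet c

/-- The common refinement of the partitions `Q i`, `i ∈ I`: the nonempty sets of the form
`⋂ i ∈ I, q i` with `q i ∈ Q i`. -/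
def commonRefinement {Ω : Type*} {n : ℕ} (Q : Fin n → Set (Set Ω)) (I : Set (Fin n)) :
    Set (Set Ω) :=
  {c | c.Nonempty ∧ ∃ q : Fin n → Set Ω, (∀ i ∈ I, q i ∈ Q i) ∧ c = ⋂ i ∈ I, q i}

/-- `⋁ {Q i : i ∈ I}`: the σ-algebra generated by the common refinement. -/
abbrev joinAlgebra {Ω : Type*} {n : ℕ} (Q : Fin n → Set (Set Ω)) (I : Set (Fin n)) :
    MeasurableSpace Ω :=
  MeasurableSpace.generateFrom (commonRefinement Q I)

/-! ### Conditional expectations evaluated at a state -/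

/-- `v` is a version of the conditional expectation of `u` given `𝒢` under `P`. The function `u`
need only be integrable on each set of a countable cover by events of `𝒢`; for integrable `u` this
is the usual notion. As usual, `E[u | 𝒢] = u` for a `𝒢`-measurable `u`; since conditional
expectations are compared state by state below, this is an equality of functions. -/
def IsCondExp {Ω : Type*} (𝒢 : MeasurableSpace Ω) [MeasurableSpace Ω] (P : Measure Ω)
    (u v : Ω → ℝ) : Prop :=
  Measurable[𝒢] v ∧ (Measurable[𝒢] u → v = u) ∧
    ∃ A : ℕ → Set Ω, (∀ k, MeasurableSet[𝒢] (A k)) ∧ (⋃ k, A k) = Set.univ ∧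
      ∀ k, IntegrableOn u (A k) P ∧ IntegrableOn v (A k) P ∧
        ∀ B ⊆ A k, MeasurableSet[𝒢] B → ∫ ω in B, v ω ∂P = ∫ ω in B, u ω ∂P

/-- `E[u | 𝒢](ω) < E[u' | 𝒢](ω)`: both conditional expectations exist, and the inequality does not
depend on the choice of versions. -/
def CondExpLT {Ω : Type*} (𝒢 : MeasurableSpace Ω) [MeasurableSpace Ω] (P : Measure Ω)
    (u u' : Ω → ℝ) (ω : Ω) : Prop :=
  (∃ v, IsCondExp 𝒢 P u v) ∧ (∃ v', IsCondExp 𝒢 P u' v') ∧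
    ∀ v v', IsCondExp 𝒢 P u v → IsCondExp 𝒢 P u' v' → v ω < v' ω

/-! ### The economy -/

/-- A mixed pure exchange economy with asymmetric information, `ℓ` commodities and finitely many
information partitions. The σ-algebras of events and of agents are the instances on `Ω` and `T`.
Only the values of `U t ω` on the nonnegative orthant matter. -/
structure Economy (Ω T : Type*) [MeasurableSpace Ω] [MeasurableSpace T] (ℓ : ℕ) where
  /-- the probability on the states of nature -/
  P : Measure Ω
  isProbabilityMeasure_P : IsProbabilityMeasure P
  isComplete_P : P.IsComplete
  /-- the measure on the agents -/
  μ : Measure T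
  isFiniteMeasure_μ : IsFiniteMeasure μ
  isComplete_μ : μ.IsComplete
  /-- the large agents -/
  atoms : Set (Set T)
  isAtomFamily_atoms : IsAtomFamily μ atoms
  /-- the number of information partitions -/
  n : ℕ
  /-- the information partitions that occur -/
  Q : Fin n → Set (Set Ω)
  isMeasurablePartition_Q : ∀ i, IsMeasurablePartition (Q i)
  /-- the information partition of each agent -/
  info : T → Set (Set Ω)
  info_mem : ∀ t, ∃ i, info t = Q i
  measurableSet_info : ∀ i, MeasurableSet {t | info t = Q i}
  /-- the utility functions -/
  U : T → Ω → (Fin ℓ → ℝ) → ℝ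
  /-- the initial endowments -/
  a : T → Ω → (Fin ℓ → ℝ)
  a_nonneg : ∀ t ω, 0 ≤ a t ω
  /-- the prior beliefs -/
  prior : T → Measure Ω
  isProbabilityMeasure_prior : ∀ t, IsProbabilityMeasure (prior t)

namespace Economy

variable {Ω T : Type*} [mΩ : MeasurableSpace Ω] [MeasurableSpace T] {ℓ : ℕ}

/-- The set `T₁` of large agents. -/
def T₁ (E : Economy Ω T ℓ) : Set T := ⋃₀ E.atoms

/-- The private information of agent `t`. -/
abbrev privateAlgebra (E : Economy Ω T ℓ) (t : T) : MeasurableSpace Ω :=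
  MeasurableSpace.generateFrom (E.info t)

/-- The members of `S` whose information partition is `Q i`. -/
def part (E : Economy Ω T ℓ) (S : Set T) (i : Fin E.n) : Set T := {t ∈ S | E.info t = E.Q i}

/-- The information partitions that are present in `S`. -/
def present (E : Economy Ω T ℓ) (S : Set T) : Set (Fin E.n) := {i | 0 < E.μ (E.part S i)}

/-! Assumptions on the economy. -/

/-- Joint measurability and integrability of the endowment, which is strictly positive. -/
def A1' (E : Economy Ω T ℓ) : Prop :=
  Measurable (fun z : T × Ω => E.a z.1 z.2) ∧
    ∀ ω, Integrable (fun t => E.a t ω) E.μ ∧ ∀ᵐ t ∂E.μ, ∀ h, 0 < E.a t ω h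

/-- Joint measurability of the utilities in agent and state. -/
def A2 (E : Economy Ω T ℓ) : Prop :=
  ∀ x : Fin ℓ → ℝ, 0 ≤ x → Measurable (fun z : T × Ω => E.U z.1 z.2 x)

/-- Utilities are continuous and strictly increasing on the nonnegative orthant. -/
def A3 (E : Economy Ω T ℓ) : Prop :=
  ∀ t ω, ContinuousOn (E.U t ω) (Set.Ici 0) ∧ StrictMonoOn (E.U t ω) (Set.Ici 0)

/-- The utilities of large agents are quasi-concave. -/
def A4' (E : Economy Ω T ℓ) : Prop :=
  ∀ t ∈ E.T₁, ∀ ω, QuasiconcaveOn ℝ (Set.Ici 0) (E.U t ω)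

/-- Every information partition is held by a non-null set of agents, these sets cover `T`, and the
partitions jointly generate the σ-algebra of events. -/
def A5 (E : Economy Ω T ℓ) : Prop :=
  (∀ i, 0 < E.μ (E.part Set.univ i)) ∧ (⋃ i, E.part Set.univ i) = Set.univ ∧
    joinAlgebra E.Q Set.univ = mΩ

/-- All large agents have the same characteristics. -/
def A6 (E : Economy Ω T ℓ) : Prop :=
  ∀ s ∈ E.T₁, ∀ t ∈ E.T₁, E.info s = E.info t ∧
    (∀ ω, ∀ x : Fin ℓ → ℝ, 0 ≤ x → E.U s ω x = E.U t ω x) ∧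
    E.a s = E.a t ∧ E.prior s = E.prior t

/-! Allocations and the fine core. -/

/-- Assignments. -/
def IsAssignment (E : Economy Ω T ℓ) (f : T → Ω → (Fin ℓ → ℝ)) : Prop :=
  (∀ t ω, 0 ≤ f t ω) ∧ (∀ ω, Integrable (fun t => f t ω) E.μ) ∧ ∀ t, Measurable (f t)

/-- Allocations: feasible assignments. -/
def IsAllocation (E : Economy Ω T ℓ) (f : T → Ω → (Fin ℓ → ℝ)) : Prop :=
  E.IsAssignment f ∧ ∀ ω, ∫ t, f t ω ∂E.μ = ∫ t, E.a t ω ∂E.μ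

/-- Coalitions. -/
def IsCoalition (E : Economy Ω T ℓ) (S : Set T) : Prop := MeasurableSet S ∧ 0 < E.μ S

/-- Information structures for `S`. Only the values of `𝒢` on `S` matter. -/
def IsInformationStructure (_E : Economy Ω T ℓ) (S : Set T)
    (𝒢 : T → MeasurableSpace Ω) : Prop :=
  (∀ t ∈ S, 𝒢 t ≤ mΩ) ∧ ∀ ℋ : MeasurableSpace Ω, ℋ ≤ mΩ → MeasurableSet {t ∈ S | 𝒢 t = ℋ}

/-- Communication systems for `S`. -/
def IsCommunicationSystem (E : Economy Ω T ℓ) (S : Set T) (𝒢 : T → MeasurableSpace Ω) : Prop :=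
  E.IsInformationStructure S 𝒢 ∧
    ∀ᵐ t ∂E.μ.restrict S, E.privateAlgebra t ≤ 𝒢 t ∧ 𝒢 t ≤ joinAlgebra E.Q (E.present S)

/-- `f` is fine blocked by `S`. -/
def FineBlocked (E : Economy Ω T ℓ) (f : T → Ω → (Fin ℓ → ℝ)) (S : Set T) : Prop :=
  ∃ (g : T → Ω → (Fin ℓ → ℝ)) (𝒢 : T → MeasurableSpace Ω) (Ω₀ : Set Ω),
    E.IsAllocation g ∧ E.IsCommunicationSystem S 𝒢 ∧
    Ω₀.Nonempty ∧ (∀ t ∈ S, MeasurableSet[𝒢 t] Ω₀) ∧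
    ∀ ω ∈ Ω₀, ∫ t in S, g t ω ∂E.μ = ∫ t in S, E.a t ω ∂E.μ ∧
      ∀ᵐ t ∂E.μ.restrict S, CondExpLT (𝒢 t) (E.prior t)
        (fun ω' => E.U t ω' (f t ω')) (fun ω' => E.U t ω' (g t ω')) ω

/-- The fine core. -/
def fineCore (E : Economy Ω T ℓ) : Set (T → Ω → (Fin ℓ → ℝ)) :=
  {f | E.IsAllocation f ∧ ∀ S, E.IsCoalition S → ¬ E.FineBlocked f S}

/-! Walrasian equilibria of the complete information economy in the state `ω`. -/

/-- The budget set of agent `t` in the state `ω` at prices `p`. -/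
def budget (E : Economy Ω T ℓ) (t : T) (ω : Ω) (p : Fin ℓ → ℝ) : Set (Fin ℓ → ℝ) :=
  {x | 0 ≤ x ∧ p ⬝ᵥ x ≤ p ⬝ᵥ E.a t ω}

/-- `(x, p)` is a Walrasian equilibrium in the state `ω`: `x` is feasible, `p` is a normalized price
vector, and almost every agent maximizes utility on the budget set. -/
def IsWalrasianEquilibrium (E : Economy Ω T ℓ) (ω : Ω) (x : T → (Fin ℓ → ℝ)) (p : Fin ℓ → ℝ) :
    Prop :=
  (∀ t, 0 ≤ x t) ∧ Integrable x E.μ ∧ ∫ t, x t ∂E.μ = ∫ t, E.a t ω ∂E.μ ∧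
    p ∈ stdSimplex ℝ (Fin ℓ) ∧
    ∀ᵐ t ∂E.μ, x t ∈ E.budget t ω p ∧ ∀ y ∈ E.budget t ω p, E.U t ω y ≤ E.U t ω (x t)

/-- The Walrasian equilibrium allocations in the state `ω`. -/
def walrasianAllocations (E : Economy Ω T ℓ) (ω : Ω) : Set (T → (Fin ℓ → ℝ)) :=
  {x | ∃ p, E.IsWalrasianEquilibrium ω x p}

end Economy

end MixedEconomy

end

open MeasureTheory

noncomputable section

namespace MixedEconomy

/-! ### Atomless measures -/

section Atomless

variable {T : Type*} [MeasurableSpace T] {ν : Measure T}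

/-! The argument reduces the theorem to complete information in a fixed state `ω`, and then shows
that a large agent facing others of the same type has no monopoly power.

Reduction (`unblockedMarket_of_mem_fineCore`). Suppose a coalition, containing a non-null set of
large agents if there are any, could leave almost no member worse off in `ω` with a surplus of every
commodity. A tiny set of small agents, kept at `f`, brings in the missing partitions and preserves
the surplus, which is then shared equally. With all information pooled, every measurable function is
constant on the cell of `ω`, so the improvement at `ω` is a fine block on that cell.

Complete information (`exists_equilibrium_price`). Atomlessness makes the closure of the aggregate
net trades of small agents convex (`convex_closure_excess`); quasi-concavity does this for the
bundles acceptable to large agents. Let `x` be the average bundle of the large agents and `A` a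
smaller group of them that finds `x` acceptable. Separation from the negative orthant gives prices
at which `x` costs exactly the endowment (`exists_price`): the support inequality for `A` gives one
bound, and balance over all agents, with `A` strictly smaller than the set of large agents, gives
the other. If an atom strictly preferred `x` to its own bundle, a contraction of `x` would be
acceptable and too cheap. If all atoms strictly preferred their own bundles, `lt_average_of_ae_lt`
would make `x` better than itself. So no atom is below `x` and some atom is not above it; the prices
obtained from that atom decentralize `f`, for the small agents by `ae_optimal_of_supporting`. -/

lemma exists_subset_measure_le_half (hν : ∀ A, ¬ IsMeasureAtom ν A) {A : Set T}
    (hA : MeasurableSet A) (hpos : 0 < ν A) :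
    ∃ B ⊆ A, MeasurableSet B ∧ 0 < ν B ∧ 2 * ν B ≤ ν A := by
  have h := hν A
  simp only [IsMeasureAtom, not_and, not_forall, not_or] at h
  obtain ⟨B, hBA, hB, h1, h2⟩ := h hA hpos
  have hsum : ν B + ν (A \ B) = ν A := by
    rw [← measure_inter_add_sdiff A hB, Set.inter_eq_right.mpr hBA]
  rcases le_total (ν B) (ν (A \ B)) with hle | hle
  · exact ⟨B, hBA, hB, pos_iff_ne_zero.mpr h1, by rw [two_mul, ← hsum]; gcongr⟩
  · exact ⟨A \ B, Set.sdiff_subset, hA.diff hB, pos_iff_ne_zero.mpr h2,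
      by rw [two_mul, ← hsum]; gcongr⟩

lemma exists_subset_measure_lt [IsFiniteMeasure ν] (hν : ∀ A, ¬ IsMeasureAtom ν A) {A : Set T}
    (hA : MeasurableSet A) (hpos : 0 < ν A) {ε : ℝ} (hε : 0 < ε) :
    ∃ B ⊆ A, MeasurableSet B ∧ 0 < ν B ∧ ν.real B < ε := by
  have key : ∀ n : ℕ, ∃ B ⊆ A, MeasurableSet B ∧ 0 < ν B ∧ 2 ^ n * ν.real B ≤ ν.real A := by
    intro n
    induction n with
    | zero => exact ⟨A, subset_rfl, hA, hpos, by simp⟩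
    | succ n ih =>
      obtain ⟨B, hBA, hB, hBpos, hBle⟩ := ih
      obtain ⟨C, hCB, hC, hCpos, hCle⟩ := exists_subset_measure_le_half hν hB hBpos
      refine ⟨C, hCB.trans hBA, hC, hCpos, le_trans ?_ hBle⟩
      have h2 : 2 * ν.real C ≤ ν.real B := by
        have := ENNReal.toReal_mono (measure_ne_top ν B) hCle
        simpa [Measure.real] using this
      calc 2 ^ (n + 1) * ν.real C = 2 ^ n * (2 * ν.real C) := by ring
        _ ≤ 2 ^ n * ν.real B := by gcongr
  obtain ⟨n, hn⟩ := pow_unbounded_of_one_lt (ν.real A / ε) (one_lt_two (α := ℝ))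
  obtain ⟨B, hBA, hB, hBpos, hBle⟩ := key n
  refine ⟨B, hBA, hB, hBpos, ?_⟩
  rw [div_lt_iff₀ hε] at hn
  exact lt_of_mul_lt_mul_left (hBle.trans_lt hn) (by positivity)

/-- A finite atomless measure takes every value between `0` and `ν A` on the subsets of `A`. -/
lemma exists_subset_measureReal_eq [IsFiniteMeasure ν] (hν : ∀ A, ¬ IsMeasureAtom ν A)
    {A : Set T} (hA : MeasurableSet A) {r : ℝ} (hr0 : 0 ≤ r) (hr : r ≤ ν.real A) :
    ∃ B ⊆ A, MeasurableSet B ∧ ν.real B = r := by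
  -- Greedy exhaustion: each stage extends the previous set to within `1 / (n + 1)` of the supremum
  -- of the measures of its admissible extensions.
  let X := {B : Set T // MeasurableSet B ∧ B ⊆ A ∧ ν.real B ≤ r}
  let V : X → Set ℝ := fun B => {x | ∃ C : X, B.1 ⊆ C.1 ∧ ν.real C.1 = x}
  have hVne : ∀ B, (V B).Nonempty := fun B => ⟨_, B, subset_rfl, rfl⟩
  have hVbdd : ∀ B, BddAbove (V B) := fun B => ⟨r, by rintro x ⟨C, -, rfl⟩; exact C.2.2.2⟩
  have step : ∀ (n : ℕ) (B : X), ∃ C : X, B.1 ⊆ C.1 ∧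
      sSup (V B) - 1 / ((n : ℝ) + 1) < ν.real C.1 := by
    intro n B
    obtain ⟨x, ⟨C, hC, rfl⟩, hlt⟩ := exists_lt_of_lt_csSup (hVne B)
      (sub_lt_self (sSup (V B)) (by positivity : (0 : ℝ) < 1 / ((n : ℝ) + 1)))
    exact ⟨C, hC, hlt⟩
  choose next hsub hlt using step
  let B : ℕ → X := fun n => Nat.rec ⟨∅, by simp [hr0]⟩ (fun n B => next n B) n
  have hmono : Monotone fun n => (B n).1 := monotone_nat_of_le_succ fun n => hsub n (B n)
  let U : Set T := ⋃ n, (B n).1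
  have hU : MeasurableSet U := MeasurableSet.iUnion fun n => (B n).2.1
  have hUA : U ⊆ A := Set.iUnion_subset fun n => (B n).2.2.1
  have htend : Filter.Tendsto (fun n => ν.real (B n).1) Filter.atTop (nhds (ν.real U)) :=
    (ENNReal.tendsto_toReal (measure_ne_top ν U)).comp (tendsto_measure_iUnion_atTop hmono)
  have hUr : ν.real U ≤ r := le_of_tendsto' htend fun n => (B n).2.2.2
  refine ⟨U, hUA, hU, hUr.antisymm ?_⟩
  by_contra! hcon
  have hpos : 0 < ν (A \ U) := by
    have : ν.real (A \ U) = ν.real A - ν.real U := measureReal_sdiff hUA hU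
    have h' : 0 < ν.real (A \ U) := by linarith
    exact (ENNReal.toReal_pos_iff.mp h').1
  obtain ⟨D, hDA, hD, hDpos, hDlt⟩ :=
    exists_subset_measure_lt hν (hA.diff hU) hpos (sub_pos.mpr hcon)
  have hDpos' : 0 < ν.real D := ENNReal.toReal_pos hDpos.ne' (measure_ne_top _ _)
  have hUD : ν.real (U ∪ D) = ν.real U + ν.real D :=
    measureReal_union (Set.disjoint_left.mpr fun x hx hx' => (hDA hx').2 hx) hD
  -- `U ∪ D` was an admissible extension at every stage, so `D` fits into every gap left by the
  -- greedy choice.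
  have hbound : ∀ n : ℕ, ν.real D ≤ 1 / ((n : ℝ) + 1) := by
    intro n
    have h1 : ν.real (U ∪ D) ≤ sSup (V (B n)) := by
      refine le_csSup (hVbdd _) ⟨⟨U ∪ D, hU.union hD,
        Set.union_subset hUA (hDA.trans Set.sdiff_subset), ?_⟩, ?_, rfl⟩
      · rw [hUD]; linarith
      · exact (Set.subset_iUnion (fun n => (B n).1) n).trans Set.subset_union_left
    have h2 := hlt n (B n)
    have h3 : ν.real (next n (B n)).1 ≤ ν.real U :=
      measureReal_mono (Set.subset_iUnion (fun n => (B n).1) (n + 1))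
    linarith
  exact absurd (ge_of_tendsto' tendsto_one_div_add_atTop_nhds_zero_nat hbound) (not_le.mpr hDpos')

/-- An approximate form of Lyapunov's convexity theorem. -/
lemma exists_setIntegral_near_smul [IsFiniteMeasure ν] (hν : ∀ A, ¬ IsMeasureAtom ν A)
    {F : Type*} [NormedAddCommGroup F] [NormedSpace ℝ F] [CompleteSpace F] {φ : T → F}
    (hφ : Integrable φ ν) {r : ℝ} (hr0 : 0 ≤ r) (hr1 : r ≤ 1) {η : ℝ} (hη : 0 < η) :
    ∃ B, MeasurableSet B ∧ ‖∫ t in B, φ t ∂ν - r • ∫ t, φ t ∂ν‖ < η := by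
  obtain ⟨s, hs, hsm⟩ := (memLp_one_iff_integrable.mpr hφ).exists_simpleFunc_eLpNorm_sub_lt
    ENNReal.one_ne_top (ε := ENNReal.ofReal (η / 2)) (by simpa using hη)
  have hsi : Integrable s ν := memLp_one_iff_integrable.mp hsm
  have hdiff : Integrable (fun t => φ t - s t) ν := hφ.sub hsi
  have hnorm : ∫ t, ‖φ t - s t‖ ∂ν < η / 2 := by
    rw [integral_norm_eq_lintegral_enorm hdiff.1]
    rw [eLpNorm_one_eq_lintegral_enorm] at hs
    exact (ENNReal.toReal_lt_of_lt_ofReal hs)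
  -- For a simple function the identity is exact: take the fraction `r` of every fiber. The
  -- approximation error enters twice, hence `η / 2`.
  have hsub : ∀ c : F, ∃ B ⊆ s ⁻¹' {c}, MeasurableSet B ∧ ν.real B = r * ν.real (s ⁻¹' {c}) :=
    fun c => exists_subset_measureReal_eq hν (s.measurableSet_fiber c) (by positivity)
      (mul_le_of_le_one_left measureReal_nonneg hr1)
  choose C hCs hC hCr using hsub
  let B : Set T := ⋃ c ∈ s.range, C c
  have hB : MeasurableSet B := Finset.measurableSet_biUnion _ fun c _ => hC c
  have hBfib : ∀ c ∈ s.range, s ⁻¹' {c} ∩ B = C c := by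
    intro c hc
    ext t
    simp only [B, Set.mem_inter_iff, Set.mem_iUnion]
    constructor
    · rintro ⟨h1, c', hc', h2⟩
      have h3 : s t = c' := hCs c' h2
      have h4 : s t = c := h1
      rwa [← h4, h3]
    · exact fun h => ⟨hCs c h, c, hc, h⟩
  have hsB : ∫ t in B, s t ∂ν = r • ∫ t, s t ∂ν := by
    rw [SimpleFunc.integral_eq_sum _ hsi, SimpleFunc.integral_eq_sum _ hsi.integrableOn,
      Finset.smul_sum]
    refine Finset.sum_congr rfl fun c hc => ?_
    rw [measureReal_restrict_apply (s.measurableSet_fiber c), hBfib c hc, hCr, mul_smul]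
  refine ⟨B, hB, ?_⟩
  have e1 : ∫ t in B, φ t ∂ν - r • ∫ t, φ t ∂ν
      = ∫ t in B, (φ t - s t) ∂ν - r • ∫ t, (φ t - s t) ∂ν := by
    rw [integral_sub hφ hsi, integral_sub hφ.integrableOn hsi.integrableOn, hsB, smul_sub]
    abel
  have e2 : ‖∫ t in B, (φ t - s t) ∂ν‖ ≤ ∫ t, ‖φ t - s t‖ ∂ν :=
    (norm_integral_le_integral_norm _).trans
      (setIntegral_le_integral hdiff.norm (Filter.Eventually.of_forall fun _ => norm_nonneg _))
  have e3 : ‖r • ∫ t, (φ t - s t) ∂ν‖ ≤ ∫ t, ‖φ t - s t‖ ∂ν := by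
    rw [norm_smul, Real.norm_of_nonneg hr0]
    exact (mul_le_of_le_one_left (norm_nonneg _) hr1).trans (norm_integral_le_integral_norm _)
  rw [e1]
  calc _ ≤ _ := norm_sub_le _ _
    _ < η := by linarith

end Atomless

/-! ### Utilities -/

section Utility

variable {α : Type*} [MeasurableSpace α] {ℓ : ℕ}

/-- A measurable family of continuous, strictly increasing utilities on the nonnegative orthant. -/
structure RegularUtility (u : α → (Fin ℓ → ℝ) → ℝ) : Prop where
  measurable : ∀ x : Fin ℓ → ℝ, 0 ≤ x → Measurable fun t => u t x
  continuousOn : ∀ t, ContinuousOn (u t) (Set.Ici 0)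
  strictMonoOn : ∀ t, StrictMonoOn (u t) (Set.Ici 0)

/-- Truncation at zero extends utilities from the orthant to the whole space, where joint
measurability and openness arguments apply. -/
lemma continuous_sup_zero : Continuous fun x : Fin ℓ → ℝ => x ⊔ 0 :=
  continuous_pi fun h => (continuous_apply h).sup continuous_const

lemma _root_.ContinuousOn.continuous_sup_zero {v : (Fin ℓ → ℝ) → ℝ}
    (hv : ContinuousOn v (Set.Ici 0)) : Continuous fun x => v (x ⊔ 0) :=
  hv.comp_continuous MixedEconomy.continuous_sup_zero fun _ => Set.mem_Ici.mpr le_sup_right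

lemma RegularUtility.measurable_comp {u : α → (Fin ℓ → ℝ) → ℝ} (hu : RegularUtility u)
    {g : α → Fin ℓ → ℝ} (hg : Measurable g) (hg0 : ∀ t, 0 ≤ g t) :
    Measurable fun t => u t (g t) := by
  have h : Measurable (Function.uncurry fun (x : Fin ℓ → ℝ) t => u t (x ⊔ 0)) :=
    measurable_uncurry_of_continuous_of_measurable
      (fun t => (hu.continuousOn t).continuous_sup_zero) fun x => hu.measurable _ le_sup_right
  have h' : Measurable fun t => u t (g t ⊔ 0) := h.comp (hg.prodMk measurable_id)
  simpa only [sup_eq_left.mpr (hg0 _)] using h'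

/-- A preference is preserved by a slight contraction of the preferred bundle. -/
lemma eventually_lt_smul {v : (Fin ℓ → ℝ) → ℝ} (hv : ContinuousOn v (Set.Ici 0))
    {y : Fin ℓ → ℝ} (hy : 0 ≤ y) {c : ℝ} (hc : c < v y) :
    ∀ᶠ r : ℝ in nhds 1, 0 ≤ r → c < v (r • y) := by
  have hcont : Continuous fun r : ℝ => v ((r • y) ⊔ 0) :=
    hv.continuous_sup_zero.comp (continuous_id.smul continuous_const)
  have h1 : c < v (((1 : ℝ) • y) ⊔ 0) := by simpa [sup_eq_left.mpr hy] using hc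
  filter_upwards [hcont.continuousAt.eventually_const_lt h1] with r hr hr0
  rwa [sup_eq_left.mpr (smul_nonneg hr0 hy)] at hr

lemma exists_lt_smul {v : (Fin ℓ → ℝ) → ℝ} (hv : ContinuousOn v (Set.Ici 0))
    {y : Fin ℓ → ℝ} (hy : 0 ≤ y) {c : ℝ} (hc : c < v y) :
    ∃ r : ℝ, 0 ≤ r ∧ r < 1 ∧ c < v (r • y) := by
  have h1 : ∀ᶠ r : ℝ in nhdsWithin 1 (Set.Iio 1), 0 ≤ r → c < v (r • y) :=
    (eventually_lt_smul hv hy hc).filter_mono nhdsWithin_le_nhds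
  have h2 : ∀ᶠ r : ℝ in nhdsWithin 1 (Set.Iio 1), 0 < r :=
    (lt_mem_nhds one_pos).filter_mono nhdsWithin_le_nhds
  obtain ⟨r, h, h0, hr⟩ := (h1.and (h2.and self_mem_nhdsWithin)).exists
  exact ⟨r, h0.le, hr, h h0.le⟩

end Utility

/-! ### Prices -/

section Price

open scoped Pointwise

variable {ℓ : ℕ}

lemma dotProduct_pos_of_ne_zero {p x : Fin ℓ → ℝ} (hp : 0 ≤ p) (hp0 : p ≠ 0)
    (hx : ∀ h, 0 < x h) : 0 < p ⬝ᵥ x := by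
  obtain ⟨k, hk⟩ := Function.ne_iff.mp hp0
  refine Finset.sum_pos' (fun h _ => mul_nonneg (hp h) (hx h).le) ⟨k, Finset.mem_univ _, ?_⟩
  exact mul_pos (lt_of_le_of_ne (hp k) (Ne.symm hk)) (hx k)

/-- The linear functional given by a price vector. -/
def priceCLM (p : Fin ℓ → ℝ) : (Fin ℓ → ℝ) →L[ℝ] ℝ :=
  ∑ h, p h • ContinuousLinearMap.proj h

lemma priceCLM_apply (p x : Fin ℓ → ℝ) : priceCLM p x = p ⬝ᵥ x := by
  simp [priceCLM, dotProduct]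

lemma continuous_dotProduct_left (p : Fin ℓ → ℝ) : Continuous fun x : Fin ℓ → ℝ => p ⬝ᵥ x :=
  (priceCLM p).continuous.congr (priceCLM_apply p)

section Integral

variable {T : Type*} [MeasurableSpace T] {ν : Measure T}

lemma integrable_dotProduct (p : Fin ℓ → ℝ) {φ : T → Fin ℓ → ℝ} (hφ : Integrable φ ν) :
    Integrable (fun t => p ⬝ᵥ φ t) ν := by
  simpa only [priceCLM_apply] using (priceCLM p).integrable_comp hφ

lemma dotProduct_integral (p : Fin ℓ → ℝ) {φ : T → Fin ℓ → ℝ} (hφ : Integrable φ ν) :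
    p ⬝ᵥ ∫ t, φ t ∂ν = ∫ t, p ⬝ᵥ φ t ∂ν := by
  simpa only [priceCLM_apply] using ((priceCLM p).integral_comp_comm hφ).symm

end Integral

/-- If no point of `Z + D` has all coordinates negative, a price vector supports `Z + D`. -/
lemma exists_supporting_price {Z D : Set (Fin ℓ → ℝ)} (hZ : Convex ℝ (closure Z))
    (hD : Convex ℝ D) (hZne : Z.Nonempty) (hDne : D.Nonempty)
    (hneg : ∀ z ∈ Z, ∀ d ∈ D, ¬ ∀ h, (z + d) h < 0) :
    ∃ p : Fin ℓ → ℝ, 0 ≤ p ∧ p ≠ 0 ∧ ∀ z ∈ Z, ∀ d ∈ D, 0 ≤ p ⬝ᵥ z + p ⬝ᵥ d := by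
  let N : Set (Fin ℓ → ℝ) := Set.univ.pi fun _ => Set.Iio 0
  have hNo : IsOpen N := isOpen_set_pi Set.finite_univ fun _ _ => isOpen_Iio
  have hNc : Convex ℝ N := convex_pi fun _ _ => convex_Iio 0
  -- Since `N` is open, a point of `closure Z` that violates disjointness can be moved into `Z`.
  -- Thus only the closure has to be convex, and an approximate Lyapunov theorem suffices.
  have hdisj : Disjoint N (closure Z + D) := by
    rw [Set.disjoint_left]
    rintro _ hx ⟨z, hz, d, hd, rfl⟩
    have hcont : Continuous fun w : Fin ℓ → ℝ => w + d := continuous_id.add continuous_const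
    obtain ⟨w, hw, hwZ⟩ := mem_closure_iff.mp hz _ (hNo.preimage hcont) hx
    exact hneg w hwZ d hd fun h => hw h (Set.mem_univ h)
  obtain ⟨φ, c, hφN, hφZ⟩ := geometric_hahn_banach_open hNc hNo (hZ.add hD) hdisj
  let p : Fin ℓ → ℝ := fun h => φ (Pi.single h 1)
  have hφp : ∀ x, φ x = p ⬝ᵥ x := by
    intro x
    have := LinearMap.pi_apply_eq_sum_univ (φ : (Fin ℓ → ℝ) →ₗ[ℝ] ℝ) x
    simp only [ContinuousLinearMap.coe_coe] at this
    rw [this, dotProduct]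
    refine Finset.sum_congr rfl fun h _ => ?_
    rw [smul_eq_mul, mul_comm]
    congr 2
    ext k
    simp [Pi.single_apply, eq_comm]
  have hN : ∀ x : Fin ℓ → ℝ, x ≤ 0 → φ x ≤ c := by
    intro x hx
    have ht : Filter.Tendsto (fun ε : ℝ => φ (x - fun _ => ε)) (nhdsWithin 0 (Set.Ioi 0))
        (nhds (φ (x - fun _ => 0))) := by
      refine Filter.Tendsto.mono_left ?_ nhdsWithin_le_nhds
      have : Continuous fun ε : ℝ => φ (x - fun _ => ε) := by fun_prop
      exact this.tendsto 0
    have hx0 : (x - fun _ => (0 : ℝ)) = x := by ext; simp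
    rw [hx0] at ht
    refine le_of_tendsto ht ?_
    filter_upwards [self_mem_nhdsWithin] with ε hε
    refine (hφN _ fun h _ => ?_).le
    have := hx h
    simp only [Pi.zero_apply] at this
    simp only [Pi.sub_apply, Set.mem_Iio]
    have : (0 : ℝ) < ε := hε
    linarith
  have hc : 0 ≤ c := by simpa using hN 0 le_rfl
  refine ⟨p, ?_, ?_, ?_⟩
  · intro h
    by_contra! hlt
    have hlt' : p h < 0 := hlt
    -- The multiple is chosen so that the functional takes the value `c + 1`, above its bound `c` on
    -- the nonpositive orthant.
    have h1 := hN (-(((c + 1) / (-p h)) • Pi.single h 1)) (by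
      rw [neg_nonpos]
      exact smul_nonneg (div_nonneg (by linarith) (by linarith)) (by simp))
    rw [map_neg, map_smul] at h1
    change -(((c + 1) / (-p h)) * p h) ≤ c at h1
    have : -(((c + 1) / (-p h)) * p h) = c + 1 := by
      have := hlt'.ne
      field_simp
    linarith
  · intro hp
    obtain ⟨z, hz⟩ := hZne
    obtain ⟨d, hd⟩ := hDne
    have h1 := hφZ _ (Set.add_mem_add (subset_closure hz) hd)
    have h2 := hφN (fun _ => -1) fun _ _ => by simp
    rw [hφp, hp, zero_dotProduct] at h1 h2
    linarith
  · intro z hz d hd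
    rw [← dotProduct_add, ← hφp]
    exact hc.trans (hφZ _ (Set.add_mem_add (subset_closure hz) hd))

end Price

/-! ### Aggregate excess demands of coalitions -/

section Excess

variable {T : Type*} [MeasurableSpace T] {ℓ : ℕ}

/-- The aggregate net trades of coalitions by which almost no member is worse off than under
`f`. -/
def excess (ν : Measure T) (u : T → (Fin ℓ → ℝ) → ℝ) (f a : T → Fin ℓ → ℝ) :
    Set (Fin ℓ → ℝ) :=
  {z | ∃ (S : Set T) (g : T → Fin ℓ → ℝ), MeasurableSet S ∧ (∀ t, 0 ≤ g t) ∧ Integrable g ν ∧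
    (∀ᵐ t ∂ν, u t (f t) ≤ u t (g t)) ∧ ∫ t in S, (g t - a t) ∂ν = z}

variable {ν : Measure T} {u : T → (Fin ℓ → ℝ) → ℝ} {f a : T → Fin ℓ → ℝ}

lemma setIntegral_mem_excess (hf0 : ∀ t, 0 ≤ f t) (hf : Integrable f ν) {S : Set T}
    (hS : MeasurableSet S) : ∫ t in S, (f t - a t) ∂ν ∈ excess ν u f a :=
  ⟨S, f, hS, hf0, hf, Filter.Eventually.of_forall fun _ => le_rfl, rfl⟩

lemma setIntegral_piecewise_union {g g' : T → Fin ℓ → ℝ} (hg : Integrable g ν)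
    (hg' : Integrable g' ν) {S S' B : Set T} (hS : MeasurableSet S) (hS' : MeasurableSet S')
    (hB : MeasurableSet B) (inst : ∀ t, Decidable (t ∈ B)) :
    ∫ t in (S ∩ B) ∪ (S' \ B), B.piecewise g g' t ∂ν
      = ∫ t in S ∩ B, g t ∂ν + ∫ t in S' \ B, g' t ∂ν := by
  have hi : Integrable (B.piecewise g g') ν :=
    Integrable.piecewise hB hg.integrableOn hg'.integrableOn
  rw [setIntegral_union (Set.disjoint_left.mpr fun t h h' => h'.2 h.2) (hS'.diff hB)
    hi.integrableOn hi.integrableOn]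
  congr 1
  · exact setIntegral_congr_fun (hS.inter hB) fun t ht => Set.piecewise_eq_of_mem _ _ _ ht.2
  · exact setIntegral_congr_fun (hS'.diff hB) fun t ht => Set.piecewise_eq_of_notMem _ _ _ ht.2

lemma convex_closure_excess [IsFiniteMeasure ν] (hν : ∀ A, ¬ IsMeasureAtom ν A)
    (ha : Integrable a ν) : Convex ℝ (closure (excess ν u f a)) := by
  classical
  intro z hz z' hz' r r' hr hr' hrr
  have key : ∀ z ∈ excess ν u f a, ∀ z' ∈ excess ν u f a,
      r • z + r' • z' ∈ closure (excess ν u f a) := by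
    rintro _ ⟨S, g, hS, hg0, hg, hgu, rfl⟩ _ ⟨S', g', hS', hg0', hg', hgu', rfl⟩
    rw [Metric.mem_closure_iff]
    intro η hη
    have hga : Integrable (fun t => g t - a t) ν := hg.sub ha
    have hga' : Integrable (fun t => g' t - a t) ν := hg'.sub ha
    have hi : Integrable (S.indicator fun t => g t - a t) ν := hga.indicator hS
    have hi' : Integrable (S'.indicator fun t => g' t - a t) ν := hga'.indicator hS'
    -- Working with the pair of net trades gives one set `B` that captures the share `r` of both.
    -- The first coalition then acts on `B` and the second on its complement, which has the share `1
    -- - r`.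
    obtain ⟨B, hB, hlt⟩ := exists_setIntegral_near_smul hν (hi.prodMk hi') hr
      (by linarith) (half_pos hη)
    rw [integral_pair hi hi', integral_pair hi.integrableOn hi'.integrableOn,
      setIntegral_indicator hS, setIntegral_indicator hS', integral_indicator hS,
      integral_indicator hS', Prod.smul_mk, Prod.mk_sub_mk, Prod.norm_mk, max_lt_iff] at hlt
    obtain ⟨h1, h2⟩ := hlt
    refine ⟨∫ t in (S ∩ B) ∪ (S' \ B), (B.piecewise g g' t - a t) ∂ν,
      ⟨_, B.piecewise g g', (hS.inter hB).union (hS'.diff hB), ?_,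
        Integrable.piecewise hB hg.integrableOn hg'.integrableOn, ?_, rfl⟩, ?_⟩
    · intro t
      by_cases ht : t ∈ B <;> simp [ht, hg0 t, hg0' t]
    · filter_upwards [hgu, hgu'] with t h h'
      by_cases ht : t ∈ B <;> simp [ht, h, h']
    · have e0 : ∀ t, B.piecewise g g' t - a t
          = B.piecewise (fun t => g t - a t) (fun t => g' t - a t) t := by
        intro t
        by_cases ht : t ∈ B <;> simp [ht]
      simp only [e0]
      rw [setIntegral_piecewise_union hga hga' hS hS' hB]
      have e1 := integral_inter_add_sdiff (s := S') hB (hga'.integrableOn (s := S'))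
      rw [Set.inter_comm B S] at h1
      rw [Set.inter_comm B S'] at h2
      have hr'' : r' = 1 - r := by linarith
      rw [← e1] at h2 ⊢
      rw [dist_eq_norm, hr'']
      refine lt_of_eq_of_lt ?_ ((norm_sub_le _ _).trans_lt (add_lt_add h2 h1) |>.trans_eq
        (add_halves η))
      congr 1
      module
  have := map_mem_closure₂ (f := fun x y : Fin ℓ → ℝ => r • x + r' • y) (by fun_prop) hz hz'
    (u := closure (excess ν u f a)) key
  rwa [closure_closure] at this

/-- If `p` supports the aggregate excess demands and `f` is on the aggregate budget, then almost
every agent maximizes utility on the budget set. -/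
lemma ae_optimal_of_supporting [IsFiniteMeasure ν] (hu : RegularUtility u) (hfm : Measurable f)
    (hf0 : ∀ t, 0 ≤ f t) (hf : Integrable f ν) (ha : Integrable a ν)
    (ha0 : ∀ᵐ t ∂ν, ∀ h, 0 < a t h)
    {p : Fin ℓ → ℝ} (hp : 0 ≤ p) (hp0 : p ≠ 0) (hsupp : ∀ z ∈ excess ν u f a, 0 ≤ p ⬝ᵥ z)
    (hbal : p ⬝ᵥ ∫ t, (f t - a t) ∂ν = 0) :
    ∀ᵐ t ∂ν, p ⬝ᵥ f t ≤ p ⬝ᵥ a t ∧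
      ∀ y : Fin ℓ → ℝ, 0 ≤ y → p ⬝ᵥ y ≤ p ⬝ᵥ a t → u t y ≤ u t (f t) := by
  classical
  have hfa : Integrable (fun t => f t - a t) ν := hf.sub ha
  have hnonneg : 0 ≤ᵐ[ν] fun t => p ⬝ᵥ (f t - a t) := by
    refine ae_nonneg_of_forall_setIntegral_nonneg (integrable_dotProduct p hfa) fun S hS _ => ?_
    rw [← dotProduct_integral p hfa.integrableOn]
    exact hsupp _ (setIntegral_mem_excess hf0 hf hS)
  have hzero : (fun t => p ⬝ᵥ (f t - a t)) =ᵐ[ν] 0 := by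
    rw [← integral_eq_zero_iff_of_nonneg_ae hnonneg (integrable_dotProduct p hfa),
      ← dotProduct_integral p hfa, hbal]
  -- Countably many test bundles keep the exceptional sets null. They suffice because being both
  -- strictly preferred and strictly cheaper than the endowment is an open condition.
  have hdense : ∀ᵐ t ∂ν, ∀ n : ℕ, u t (f t) < u t (TopologicalSpace.denseSeq (Fin ℓ → ℝ) n ⊔ 0) →
      p ⬝ᵥ a t ≤ p ⬝ᵥ (TopologicalSpace.denseSeq (Fin ℓ → ℝ) n ⊔ 0) := by
    rw [ae_all_iff]
    intro n
    set x : Fin ℓ → ℝ := TopologicalSpace.denseSeq (Fin ℓ → ℝ) n ⊔ 0 with hx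
    have hx0 : 0 ≤ x := le_sup_right
    let W : Set T := {t | u t (f t) < u t x}
    have hW : MeasurableSet W :=
      measurableSet_lt (hu.measurable_comp hfm hf0) (hu.measurable x hx0)
    have hxa : Integrable (fun t => x - a t) ν := (integrable_const x).sub ha
    have h1 : 0 ≤ᵐ[ν.restrict W] fun t => p ⬝ᵥ (x - a t) := by
      refine ae_nonneg_of_forall_setIntegral_nonneg
        (integrable_dotProduct p hxa.integrableOn) fun S hS _ => ?_
      rw [← dotProduct_integral p hxa.integrableOn.integrableOn, Measure.restrict_restrict hS]
      refine hsupp _ ⟨S ∩ W, W.piecewise (fun _ => x) f, hS.inter hW, ?_,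
        Integrable.piecewise hW (integrable_const x).integrableOn hf.integrableOn, ?_, ?_⟩
      · intro t
        by_cases ht : t ∈ W <;> simp [ht, hx0, hf0 t]
      · refine Filter.Eventually.of_forall fun t => ?_
        by_cases ht : t ∈ W
        · simpa [ht] using le_of_lt (show u t (f t) < u t x from ht)
        · simp [ht]
      · refine setIntegral_congr_fun (hS.inter hW) fun t ht => ?_
        simp [ht.2]
    rw [Filter.EventuallyLE, ae_restrict_iff' hW] at h1
    filter_upwards [h1] with t ht htW
    have := ht htW
    rw [dotProduct_sub] at this
    simpa using this
  filter_upwards [hzero, hdense, ha0] with t hz hd hapos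
  have hz' : p ⬝ᵥ f t - p ⬝ᵥ a t = 0 := by rw [← dotProduct_sub]; exact hz
  refine ⟨by linarith, fun y hy hyb => ?_⟩
  by_contra! hlt
  have hpa := dotProduct_pos_of_ne_zero hp hp0 hapos
  -- Positive wealth makes the contracted bundle strictly cheaper than the endowment, while it
  -- remains strictly preferred.
  obtain ⟨r, hr0, hr1, hr⟩ := exists_lt_smul (hu.continuousOn t) hy hlt
  have hry : 0 ≤ r • y := smul_nonneg hr0 hy
  let O : Set (Fin ℓ → ℝ) := {x | p ⬝ᵥ (x ⊔ 0) < p ⬝ᵥ a t ∧ u t (f t) < u t (x ⊔ 0)}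
  have hO : IsOpen O :=
    (isOpen_lt ((continuous_dotProduct_left p).comp continuous_sup_zero)
      continuous_const).inter
      (isOpen_lt continuous_const (hu.continuousOn t).continuous_sup_zero)
  have hyO : r • y ∈ O := by
    simp only [O, Set.mem_ofPred_eq, sup_eq_left.mpr hry]
    refine ⟨?_, hr⟩
    rw [dotProduct_smul, smul_eq_mul]
    calc r * (p ⬝ᵥ y) ≤ r * (p ⬝ᵥ a t) := by gcongr
      _ < p ⬝ᵥ a t := by nlinarith
  obtain ⟨n, hn⟩ :=
    (TopologicalSpace.denseRange_denseSeq (Fin ℓ → ℝ)).exists_mem_open hO ⟨_, hyO⟩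
  exact absurd (hd n hn.2) (not_le.mpr hn.1)

end Excess

/-! ### Markets with atoms -/

section Market

variable {T : Type*} [MeasurableSpace T] {ℓ : ℕ}

lemma exists_measure_pos_of_ae_exists {ν : Measure T} [NeZero ν] {W : ℕ → Set T}
    (h : ∀ᵐ t ∂ν, ∃ n, t ∈ W n) : ∃ n, 0 < ν (W n) := by
  by_contra! hcon
  have h0 : ν (⋃ n, W n) = 0 := measure_iUnion_null fun n => nonpos_iff_eq_zero.mp (hcon n)
  have h1 : ∀ᵐ t ∂ν, t ∉ ⋃ n, W n := measure_eq_zero_iff_ae_notMem.mp h0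
  obtain ⟨t, ⟨n, hn⟩, ht⟩ := (h.and h1).exists
  exact ht (Set.mem_iUnion.mpr ⟨n, hn⟩)

/-- The dichotomy defining an atom settles every measurable comparison of utilities for the whole
atom at once, so bundles need not be shown to be constant on atoms. -/
lemma IsMeasureAtom.ae_mem {μ : Measure T} {A W : Set T} (hA : IsMeasureAtom μ A)
    (hW : MeasurableSet W) (h : μ (A ∩ W) ≠ 0) : ∀ᵐ t ∂μ.restrict A, t ∈ W := by
  have h0 : μ (A \ (A ∩ W)) = 0 :=
    (hA.2.2 _ Set.inter_subset_left (hA.1.inter hW)).resolve_left h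
  rw [ae_restrict_iff' hA.1]
  filter_upwards [measure_eq_zero_iff_ae_notMem.mp h0] with t ht htA
  by_contra htW
  exact ht ⟨htA, fun h => htW h.2⟩

lemma IsMeasureAtom.ae_mem_of_not_ae {μ : Measure T} {A W : Set T} (hA : IsMeasureAtom μ A)
    (hW : MeasurableSet W) (h : ¬ ∀ᵐ t ∂μ.restrict A, t ∉ W) : ∀ᵐ t ∂μ.restrict A, t ∈ W := by
  refine hA.ae_mem hW fun h0 => h ?_
  rw [ae_restrict_iff' hA.1]
  filter_upwards [measure_eq_zero_iff_ae_notMem.mp h0] with t ht htA htW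
  exact ht ⟨htA, htW⟩

lemma one_sub_one_div_mem (n : ℕ) :
    0 ≤ 1 - 1 / ((n : ℝ) + 1) ∧ 1 - 1 / ((n : ℝ) + 1) < 1 := by
  constructor
  · rw [sub_nonneg, div_le_one (by positivity)]
    linarith [n.cast_nonneg (α := ℝ)]
  · have : 0 < 1 / ((n : ℝ) + 1) := by positivity
    linarith

lemma exists_lt_smul_one_sub {v : (Fin ℓ → ℝ) → ℝ} (hv : ContinuousOn v (Set.Ici 0))
    {y : Fin ℓ → ℝ} (hy : 0 ≤ y) {c : ℝ} (hc : c < v y) :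
    ∃ n : ℕ, c < v ((1 - 1 / ((n : ℝ) + 1)) • y) := by
  have ht : Filter.Tendsto (fun n : ℕ => 1 - 1 / ((n : ℝ) + 1)) Filter.atTop (nhds 1) := by
    simpa using tendsto_const_nhds.sub (tendsto_one_div_add_atTop_nhds_zero_nat (𝕜 := ℝ))
  obtain ⟨n, hn⟩ := (ht.eventually (eventually_lt_smul hv hy hc)).exists
  exact ⟨n, hn (one_sub_one_div_mem n).1⟩

/-- A strict form of Jensen's inequality for monotone quasi-concave functions. -/
lemma lt_average_of_ae_lt {ν : Measure T} [IsFiniteMeasure ν] [NeZero ν]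
    {v : (Fin ℓ → ℝ) → ℝ} (hvc : ContinuousOn v (Set.Ici 0)) (hvm : StrictMonoOn v (Set.Ici 0))
    (hvq : QuasiconcaveOn ℝ (Set.Ici 0) v) {φ : T → Fin ℓ → ℝ} (hφ0 : ∀ t, 0 ≤ φ t)
    (hφm : Measurable φ) (hφ : Integrable φ ν) {c : ℝ} (h : ∀ᵐ t ∂ν, c < v (φ t)) :
    c < v (⨍ t, φ t ∂ν) := by
  classical
  have hv : RegularUtility fun _ : T => v :=
    ⟨fun _ _ => measurable_const, fun _ => hvc, fun _ => hvm⟩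
  obtain ⟨n, hn⟩ := exists_measure_pos_of_ae_exists
    (W := fun n : ℕ => {t | c < v ((1 - 1 / ((n : ℝ) + 1)) • φ t)})
    (h.mono fun t ht => exists_lt_smul_one_sub hvc (hφ0 t) ht)
  obtain ⟨hr0, hr1⟩ := one_sub_one_div_mem n
  set r : ℝ := 1 - 1 / ((n : ℝ) + 1)
  set B : Set T := {t | c < v (r • φ t)}
  have hB : MeasurableSet B := measurableSet_lt measurable_const
    (hv.measurable_comp (hφm.const_smul r) fun t => smul_nonneg hr0 (hφ0 t))
  -- Contracting on the non-null set `B` keeps the values at least `c`, so ordinary Jensen gives `c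
  -- ≤ v` at the average of `φ'`. Strictness comes from the amount saved, or, if nothing is saved,
  -- from `φ` vanishing somewhere in `B`, whence `c < v 0`.
  let φ' : T → Fin ℓ → ℝ := B.piecewise (fun t => r • φ t) φ
  have hφ' : Integrable φ' ν :=
    Integrable.piecewise hB (hφ.smul r).integrableOn hφ.integrableOn
  let K : Set (Fin ℓ → ℝ) := {x | x ∈ Set.Ici 0 ∧ c ≤ v x}
  have hK : IsClosed K := hvc.preimage_isClosed_of_isClosed isClosed_Ici isClosed_Ici
  have hmem : ∀ᵐ t ∂ν, φ' t ∈ K := by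
    filter_upwards [h] with t ht
    by_cases htB : t ∈ B
    · simp only [φ', Set.piecewise_eq_of_mem _ _ _ htB]
      exact ⟨smul_nonneg hr0 (hφ0 t), le_of_lt htB⟩
    · simp only [φ', Set.piecewise_eq_of_notMem _ _ _ htB]
      exact ⟨hφ0 t, ht.le⟩
  obtain ⟨havg0, havg⟩ := (hvq c).average_mem hK hmem hφ'
  have hle : φ' ≤ φ := by
    intro t
    by_cases htB : t ∈ B
    · simp only [φ', Set.piecewise_eq_of_mem _ _ _ htB]
      exact smul_le_of_le_one_left (hφ0 t) hr1.le
    · simp only [φ', Set.piecewise_eq_of_notMem _ _ _ htB, le_refl]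
  have hint : ∫ t, φ' t ∂ν ≤ ∫ t, φ t ∂ν := integral_mono hφ' hφ hle
  have hMpos : 0 < (ν.real Set.univ)⁻¹ :=
    inv_pos.mpr (ENNReal.toReal_pos (by simpa using NeZero.ne ν) (measure_ne_top _ _))
  have hle' : ⨍ t, φ' t ∂ν ≤ ⨍ t, φ t ∂ν := by
    rw [average_eq, average_eq]
    exact smul_le_smul_of_nonneg_left hint hMpos.le
  have havg1 : 0 ≤ ⨍ t, φ t ∂ν := le_trans havg0 hle'
  by_cases heq : ∫ t, φ' t ∂ν = ∫ t, φ t ∂ν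
  · have hdiff : Integrable (fun t => φ t - φ' t) ν := hφ.sub hφ'
    have hz : ∫ t, (1 : Fin ℓ → ℝ) ⬝ᵥ (φ t - φ' t) ∂ν = 0 := by
      rw [← dotProduct_integral _ hdiff, integral_sub hφ hφ', heq, sub_self, dotProduct_zero]
    rw [integral_eq_zero_iff_of_nonneg
      (fun t => dotProduct_nonneg_of_nonneg zero_le_one (sub_nonneg.mpr (hle t)))
      (integrable_dotProduct _ hdiff)] at hz
    obtain ⟨t, htB, ht⟩ : ∃ t, t ∈ B ∧ (1 : Fin ℓ → ℝ) ⬝ᵥ (φ t - φ' t) = 0 := by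
      by_contra! hcon
      refine hn.ne' (measure_mono_null (fun t ht => ?_) (ae_iff.mp hz))
      exact hcon t ht
    have hφt : φ t = 0 := by
      simp only [φ', Set.piecewise_eq_of_mem _ _ _ htB] at ht
      rw [show φ t - r • φ t = (1 - r) • φ t by module, dotProduct_smul, smul_eq_mul,
        mul_eq_zero, or_iff_right (by linarith)] at ht
      by_contra hne
      obtain ⟨k, hk⟩ := Function.ne_iff.mp hne
      have : 0 < (1 : Fin ℓ → ℝ) ⬝ᵥ φ t :=
        Finset.sum_pos' (fun h _ => mul_nonneg zero_le_one (hφ0 t h)) ⟨k, Finset.mem_univ _,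
          mul_pos one_pos (lt_of_le_of_ne (hφ0 t k) (Ne.symm hk))⟩
      exact this.ne' ht
    have hc0 : c < v 0 := by
      have : c < v (r • φ t) := htB
      rwa [hφt, smul_zero] at this
    exact hc0.trans_le (hvm.monotoneOn (Set.mem_Ici.mpr le_rfl) (Set.mem_Ici.mpr havg1) havg1)
  · refine lt_of_le_of_lt havg (hvm havg0 (Set.mem_Ici.mpr havg1) (lt_of_le_of_ne hle' ?_))
    rw [average_eq, average_eq]
    exact fun h => heq (smul_right_injective _ hMpos.ne' h)

/-- A market with measurable agents and atoms of a single type, and an allocation `f` that no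
coalition containing a non-null set of large agents (if there are any) can improve upon with a
surplus of every commodity. -/
structure UnblockedMarket (μ : Measure T) (𝒜 : Set (Set T)) (u : T → (Fin ℓ → ℝ) → ℝ)
    (f a : T → Fin ℓ → ℝ) : Prop where
  isAtomFamily : IsAtomFamily μ 𝒜
  regular : RegularUtility u
  measurable_f : Measurable f
  f_nonneg : ∀ t, 0 ≤ f t
  integrable_f : Integrable f μ
  integrable_a : Integrable a μ
  a_pos : ∀ᵐ t ∂μ, ∀ h, 0 < a t h
  balanced : ∫ t, f t ∂μ = ∫ t, a t ∂μ
  utility_eq : ∀ s ∈ ⋃₀ 𝒜, ∀ t ∈ ⋃₀ 𝒜, ∀ x : Fin ℓ → ℝ, 0 ≤ x → u s x = u t x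
  endowment_eq : ∀ s ∈ ⋃₀ 𝒜, ∀ t ∈ ⋃₀ 𝒜, a s = a t
  quasiconcave : ∀ t ∈ ⋃₀ 𝒜, QuasiconcaveOn ℝ (Set.Ici 0) (u t)
  unblocked : ∀ (S : Set T) (g : T → Fin ℓ → ℝ), MeasurableSet S → (∀ t, 0 ≤ g t) →
    Integrable g μ → (∀ᵐ t ∂μ, u t (f t) ≤ u t (g t)) →
    ((⋃₀ 𝒜).Nonempty → 0 < μ (S ∩ ⋃₀ 𝒜)) → ¬ ∀ h, (∫ t in S, (g t - a t) ∂μ) h < 0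

lemma IsAtomFamily.measurableSet_sUnion {μ : Measure T} {𝒜 : Set (Set T)}
    (h : IsAtomFamily μ 𝒜) : MeasurableSet (⋃₀ 𝒜) :=
  MeasurableSet.sUnion h.countable fun A hA => (h.isAtom A hA).1

lemma IsAtomFamily.atomless_restrict {μ : Measure T} {𝒜 : Set (Set T)} (h : IsAtomFamily μ 𝒜)
    (A : Set T) : ¬ IsMeasureAtom (μ.restrict (⋃₀ 𝒜)ᶜ) A := by
  rintro ⟨hA, hpos, hatom⟩
  have hm := h.measurableSet_sUnion.compl
  refine h.atomless_compl (A ∩ (⋃₀ 𝒜)ᶜ) Set.inter_subset_right ⟨hA.inter hm, ?_, ?_⟩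
  · rwa [Measure.restrict_apply hA] at hpos
  · intro B hB hBm
    have := hatom B (hB.trans Set.inter_subset_left) hBm
    rw [Measure.restrict_apply hBm, Measure.restrict_apply (hA.diff hBm),
      Set.inter_eq_left.mpr (hB.trans Set.inter_subset_right)] at this
    rwa [Set.inter_sdiff_right_comm]

namespace UnblockedMarket

variable {μ : Measure T} {𝒜 : Set (Set T)} {u : T → (Fin ℓ → ℝ) → ℝ}
  {f a : T → Fin ℓ → ℝ}

lemma integral_compl_add [IsFiniteMeasure μ] (M : UnblockedMarket μ 𝒜 u f a) :
    ∫ t in (⋃₀ 𝒜)ᶜ, (f t - a t) ∂μ + ∫ t in ⋃₀ 𝒜, (f t - a t) ∂μ = 0 := by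
  have hfa : Integrable (fun t => f t - a t) μ := M.integrable_f.sub M.integrable_a
  rw [add_comm, integral_add_compl M.isAtomFamily.measurableSet_sUnion hfa,
    integral_sub M.integrable_f M.integrable_a, M.balanced,
    sub_self]

lemma setIntegral_sUnion [IsFiniteMeasure μ] (M : UnblockedMarket μ 𝒜 u f a) {s : T}
    (hs : s ∈ ⋃₀ 𝒜) :
    ∫ t in ⋃₀ 𝒜, (f t - a t) ∂μ = μ.real (⋃₀ 𝒜) • ((⨍ t in ⋃₀ 𝒜, f t ∂μ) - a s) := by
  rw [integral_sub M.integrable_f.integrableOn M.integrable_a.integrableOn, smul_sub,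
    measure_smul_setAverage _ (measure_ne_top _ _),
    setIntegral_congr_fun M.isAtomFamily.measurableSet_sUnion
      (fun t ht => M.endowment_eq t ht s hs), setIntegral_const]

/-- The bundles that almost all members of `A`, with the utility of agent `s`, weakly prefer to
their own. -/
def preferred (μ : Measure T) (u : T → (Fin ℓ → ℝ) → ℝ) (f : T → Fin ℓ → ℝ) (s : T) (A : Set T) :
    Set (Fin ℓ → ℝ) :=
  {y | 0 ≤ y ∧ ∀ᵐ t ∂μ.restrict A, u t (f t) ≤ u s y}

/-- Quasi-concavity of the large agents supplies here the convexity that atomlessness supplies for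
the small ones. -/
lemma convex_preferred (M : UnblockedMarket μ 𝒜 u f a) {s : T} (hs : s ∈ ⋃₀ 𝒜) (A : Set T) :
    Convex ℝ (preferred μ u f s A) := by
  rintro y ⟨hy0, hy⟩ y' ⟨hy0', hy'⟩ b b' hb hb' hbb
  refine ⟨add_nonneg (smul_nonneg hb hy0) (smul_nonneg hb' hy0'), ?_⟩
  filter_upwards [hy, hy'] with t ht ht'
  exact (M.quasiconcave s hs (u t (f t)) ⟨hy0, ht⟩ ⟨hy0', ht'⟩ hb hb' hbb).2

lemma not_neg_add [IsFiniteMeasure μ] (M : UnblockedMarket μ 𝒜 u f a) {s : T}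
    (hs : s ∈ ⋃₀ 𝒜) {A : Set T} (hA : MeasurableSet A) (hAT : A ⊆ ⋃₀ 𝒜) (hApos : 0 < μ A)
    {z y : Fin ℓ → ℝ}
    (hz : z ∈ excess (μ.restrict (⋃₀ 𝒜)ᶜ) u f a) (hy : y ∈ preferred μ u f s A) :
    ¬ ∀ h, (z + μ.real A • (y - a s)) h < 0 := by
  classical
  obtain ⟨S, g, hS, hg0, hg, hgu, rfl⟩ := hz
  obtain ⟨hy0, hy⟩ := hy
  have hT := M.isAtomFamily.measurableSet_sUnion
  have hdisj : Disjoint (S ∩ (⋃₀ 𝒜)ᶜ) A := Set.disjoint_left.mpr fun t ht htA => ht.2 (hAT htA)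
  -- The large agents outside `A` keep `f`, because `unblocked` asks for weak improvement almost
  -- everywhere and not only in the coalition.
  let g' : T → Fin ℓ → ℝ := A.piecewise (fun _ => y) ((⋃₀ 𝒜)ᶜ.piecewise g f)
  have hgA : ∀ t ∈ A, g' t = y := fun t ht => by simp [g', ht]
  have hgT : ∀ t ∉ ⋃₀ 𝒜, g' t = g t := fun t ht => by
    have h1 : t ∉ A := fun h => ht (hAT h)
    have h2 : t ∈ (⋃₀ 𝒜)ᶜ := ht
    simp only [g', Set.piecewise_eq_of_notMem _ _ _ h1, Set.piecewise_eq_of_mem _ _ _ h2]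
  have hgf : ∀ t ∈ ⋃₀ 𝒜, t ∉ A → g' t = f t := fun t ht h1 => by
    have h2 : t ∉ (⋃₀ 𝒜)ᶜ := fun h => h ht
    simp only [g', Set.piecewise_eq_of_notMem _ _ _ h1, Set.piecewise_eq_of_notMem _ _ _ h2]
  have hg' : Integrable g' μ := Integrable.piecewise hA (integrable_const y).integrableOn
    (Integrable.piecewise hT.compl hg M.integrable_f.integrableOn).integrableOn
  have hint : ∫ t in (S ∩ (⋃₀ 𝒜)ᶜ) ∪ A, (g' t - a t) ∂μ
      = ∫ t in S, (g t - a t) ∂μ.restrict (⋃₀ 𝒜)ᶜ + μ.real A • (y - a s) := by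
    have hi : Integrable (fun t => g' t - a t) μ := hg'.sub M.integrable_a
    rw [setIntegral_union hdisj hA hi.integrableOn hi.integrableOn, Measure.restrict_restrict hS]
    congr 1
    · refine setIntegral_congr_fun (hS.inter hT.compl) fun t ht => ?_
      simp only [hgT t ht.2]
    · rw [← setIntegral_const]
      refine setIntegral_congr_fun hA fun t ht => ?_
      simp only [hgA t ht, M.endowment_eq t (hAT ht) s hs]
  rw [← hint]
  refine M.unblocked _ g' ((hS.inter hT.compl).union hA) ?_ hg' ?_ fun _ => ?_
  · intro t
    by_cases ht : t ∈ ⋃₀ 𝒜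
    · by_cases htA : t ∈ A
      · rw [hgA t htA]; exact hy0
      · rw [hgf t ht htA]; exact M.f_nonneg t
    · rw [hgT t ht]; exact hg0 t
  · rw [ae_restrict_iff' hT.compl] at hgu
    rw [ae_restrict_iff' hA] at hy
    filter_upwards [hgu, hy] with t h1 h2
    by_cases ht : t ∈ ⋃₀ 𝒜
    · by_cases htA : t ∈ A
      · rw [hgA t htA, M.utility_eq t ht s hs y hy0]; exact h2 htA
      · rw [hgf t ht htA]
    · rw [hgT t ht]; exact h1 ht
  · exact hApos.trans_le (measure_mono fun t ht => ⟨Or.inr ht, hAT ht⟩)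

/-- Supporting prices obtained from a group `A` of large agents to whom the average bundle of all
large agents is acceptable. -/
lemma exists_price [IsFiniteMeasure μ] (M : UnblockedMarket μ 𝒜 u f a) {s : T}
    (hs : s ∈ ⋃₀ 𝒜) {A : Set T} (hA : MeasurableSet A) (hAT : A ⊆ ⋃₀ 𝒜) (hApos : 0 < μ A)
    (hlt : μ.real A < μ.real (⋃₀ 𝒜)) (havg : ⨍ t in ⋃₀ 𝒜, f t ∂μ ∈ preferred μ u f s A) :
    ∃ p : Fin ℓ → ℝ, 0 ≤ p ∧ p ≠ 0 ∧
      (∀ z ∈ excess (μ.restrict (⋃₀ 𝒜)ᶜ) u f a, 0 ≤ p ⬝ᵥ z) ∧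
      p ⬝ᵥ ∫ t in (⋃₀ 𝒜)ᶜ, (f t - a t) ∂μ = 0 ∧
      p ⬝ᵥ ⨍ t in ⋃₀ 𝒜, f t ∂μ = p ⬝ᵥ a s ∧ ∀ y ∈ preferred μ u f s A, p ⬝ᵥ a s ≤ p ⬝ᵥ y := by
  set x : Fin ℓ → ℝ := ⨍ t in ⋃₀ 𝒜, f t ∂μ with hx
  have hm : 0 < μ.real A := ENNReal.toReal_pos hApos.ne' (measure_ne_top _ _)
  have hconv : Convex ℝ ((fun y => μ.real A • (y - a s)) '' preferred μ u f s A) := by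
    rintro _ ⟨y, hy, rfl⟩ _ ⟨y', hy', rfl⟩ b b' hb hb' hbb
    refine ⟨b • y + b' • y', M.convex_preferred hs A hy hy' hb hb' hbb, ?_⟩
    have : b' = 1 - b := by linarith
    subst this
    module
  have h0 : (0 : Fin ℓ → ℝ) ∈ excess (μ.restrict (⋃₀ 𝒜)ᶜ) u f a := by
    simpa using setIntegral_mem_excess (u := u) (a := a) M.f_nonneg
      (M.integrable_f.integrableOn (s := (⋃₀ 𝒜)ᶜ)) MeasurableSet.empty
  have hall : ∫ t in (⋃₀ 𝒜)ᶜ, (f t - a t) ∂μ ∈ excess (μ.restrict (⋃₀ 𝒜)ᶜ) u f a := by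
    simpa using setIntegral_mem_excess (u := u) (a := a) M.f_nonneg
      (M.integrable_f.integrableOn (s := (⋃₀ 𝒜)ᶜ)) MeasurableSet.univ
  obtain ⟨p, hp, hp0, hsupp⟩ := exists_supporting_price
    (convex_closure_excess M.isAtomFamily.atomless_restrict M.integrable_a.integrableOn) hconv
    ⟨_, h0⟩ ⟨_, Set.mem_image_of_mem _ havg⟩ (by
      rintro z hz _ ⟨y, hy, rfl⟩
      exact M.not_neg_add hs hA hAT hApos hz hy)
  have hsupp' : ∀ z ∈ excess (μ.restrict (⋃₀ 𝒜)ᶜ) u f a, ∀ y ∈ preferred μ u f s A,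
      0 ≤ p ⬝ᵥ z + μ.real A * (p ⬝ᵥ y - p ⬝ᵥ a s) := by
    intro z hz y hy
    have := hsupp z hz _ (Set.mem_image_of_mem _ hy)
    simpa only [dotProduct_smul, dotProduct_sub, smul_eq_mul] using this
  have hbal := congrArg (fun w => p ⬝ᵥ w) M.integral_compl_add
  simp only [M.setIntegral_sUnion hs, dotProduct_add, dotProduct_smul, dotProduct_sub,
    smul_eq_mul, dotProduct_zero] at hbal
  rw [← hx] at hbal
  have h1 := hsupp' _ h0 x havg
  have h2 := hsupp' _ hall x havg
  rw [dotProduct_zero, zero_add] at h1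
  have h1' : 0 ≤ p ⬝ᵥ x - p ⬝ᵥ a s := nonneg_of_mul_nonneg_right h1 hm
  -- Substituting `hbal` in `h2` gives `(μ.real A - μ.real (⋃₀ 𝒜)) * (p ⬝ᵥ x - p ⬝ᵥ a s) ≥ 0`. As
  -- the first factor is negative by `hlt`, this reverses `h1'`.
  have heq : p ⬝ᵥ x - p ⬝ᵥ a s = 0 := by nlinarith
  rw [heq, mul_zero, add_zero] at hbal
  refine ⟨p, hp, hp0, fun z hz => ?_, hbal, by linarith, fun y hy => ?_⟩
  · have := hsupp' z hz x havg
    rwa [heq, mul_zero, add_zero] at this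
  · have := hsupp' _ h0 y hy
    rw [dotProduct_zero, zero_add] at this
    linarith [nonneg_of_mul_nonneg_right this hm]

lemma ae_restrict_sUnion (M : UnblockedMarket μ 𝒜 u f a) {q : T → Prop}
    (h : ∀ A ∈ 𝒜, ∀ᵐ t ∂μ.restrict A, q t) : ∀ᵐ t ∂μ.restrict (⋃₀ 𝒜), q t := by
  rw [Set.sUnion_eq_biUnion, ae_restrict_biUnion_iff _ M.isAtomFamily.countable]
  exact h

lemma measureReal_atom_lt [IsFiniteMeasure μ] (M : UnblockedMarket μ 𝒜 u f a)
    (h𝒜 : 2 ≤ 𝒜.encard) {A : Set T} (hA : A ∈ 𝒜) : μ.real A < μ.real (⋃₀ 𝒜) := by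
  obtain ⟨A', hA', hne⟩ : ∃ A' ∈ 𝒜, A' ≠ A :=
    (Set.one_lt_encard_iff_nontrivial.mp (lt_of_lt_of_le (by norm_num) h𝒜)).exists_ne A
  have hm' := M.isAtomFamily.isAtom A' hA'
  have hdisj : Disjoint A A' := M.isAtomFamily.pairwiseDisjoint hA hA' hne.symm
  have h1 : μ.real (A ∪ A') = μ.real A + μ.real A' := measureReal_union hdisj hm'.1
  have h2 : μ.real (A ∪ A') ≤ μ.real (⋃₀ 𝒜) := measureReal_mono
    (Set.union_subset (Set.subset_sUnion_of_mem hA) (Set.subset_sUnion_of_mem hA'))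
  have h3 : 0 < μ.real A' := ENNReal.toReal_pos hm'.2.1.ne' (measure_ne_top _ _)
  linarith

/-- An unblocked allocation of a market without large agents, or with at least two of them, is
supported by a price vector. -/
theorem exists_equilibrium_price [IsFiniteMeasure μ] (M : UnblockedMarket μ 𝒜 u f a)
    (h𝒜 : 2 ≤ 𝒜.encard ∨ 𝒜 = ∅) :
    ∃ p : Fin ℓ → ℝ, 0 ≤ p ∧ p ≠ 0 ∧ ∀ᵐ t ∂μ, p ⬝ᵥ f t ≤ p ⬝ᵥ a t ∧
      ∀ y : Fin ℓ → ℝ, 0 ≤ y → p ⬝ᵥ y ≤ p ⬝ᵥ a t → u t y ≤ u t (f t) := by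
  have hT := M.isAtomFamily.measurableSet_sUnion
  rcases h𝒜 with h𝒜 | rfl
  · have hne : 𝒜.Nonempty := by
      rw [← Set.encard_ne_zero]
      rintro h0
      simp [h0] at h𝒜
    obtain ⟨A₀, hA₀⟩ := hne
    have hTpos : 0 < μ (⋃₀ 𝒜) :=
      (M.isAtomFamily.isAtom A₀ hA₀).2.1.trans_le (measure_mono (Set.subset_sUnion_of_mem hA₀))
    have hNeZero : NeZero (μ.restrict (⋃₀ 𝒜)) :=
      ⟨fun h => hTpos.ne' (Measure.restrict_eq_zero.mp h)⟩
    obtain ⟨s, hapos, hs⟩ : ∃ s, (∀ h, 0 < a s h) ∧ s ∈ ⋃₀ 𝒜 :=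
      ((ae_restrict_of_ae M.a_pos).and (ae_restrict_mem hT)).exists
    set x : Fin ℓ → ℝ := ⨍ t in ⋃₀ 𝒜, f t ∂μ with hx
    have hx0 : 0 ≤ x := (convex_Ici (𝕜 := ℝ) (0 : Fin ℓ → ℝ)).average_mem isClosed_Ici
      (Filter.Eventually.of_forall M.f_nonneg) M.integrable_f.integrableOn
    have hum : Measurable fun t => u t (f t) :=
      M.regular.measurable_comp M.measurable_f M.f_nonneg
    have hge : ∀ᵐ t ∂μ.restrict (⋃₀ 𝒜), u s x ≤ u t (f t) := by
      refine M.ae_restrict_sUnion fun A hA => ?_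
      have hatom := M.isAtomFamily.isAtom A hA
      have hANeZero : NeZero (μ.restrict A) :=
        ⟨fun h => hatom.2.1.ne' (Measure.restrict_eq_zero.mp h)⟩
      by_contra hcon
      have hlt : ∀ᵐ t ∂μ.restrict A, u t (f t) < u s x :=
        hatom.ae_mem_of_not_ae (W := {t | u t (f t) < u s x})
          (measurableSet_lt hum measurable_const) (by simpa using hcon)
      obtain ⟨n, hn⟩ := exists_measure_pos_of_ae_exists
        (W := fun n : ℕ => {t | u t (f t) < u s ((1 - 1 / ((n : ℝ) + 1)) • x)})
        (hlt.mono fun t ht => exists_lt_smul_one_sub (M.regular.continuousOn s) hx0 ht)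
      obtain ⟨hr0, hr1⟩ := one_sub_one_div_mem n
      set r : ℝ := 1 - 1 / ((n : ℝ) + 1)
      have hWm : MeasurableSet {t | u t (f t) < u s (r • x)} :=
        measurableSet_lt hum measurable_const
      rw [Measure.restrict_apply hWm, Set.inter_comm] at hn
      have hr := hatom.ae_mem hWm hn.ne'
      -- At these prices `x` costs as much as the endowment, the least cost of a bundle acceptable
      -- to `A`. But `r • x` is acceptable too, and cheaper.
      obtain ⟨p, hp, hp0, -, -, hpx, hpy⟩ := M.exists_price hs hatom.1
        (Set.subset_sUnion_of_mem hA) hatom.2.1 (M.measureReal_atom_lt h𝒜 hA)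
        ⟨hx0, hlt.mono fun _ h => h.le⟩
      have h1 := hpy (r • x) ⟨smul_nonneg hr0 hx0, hr.mono fun _ h => le_of_lt h⟩
      have h2 := dotProduct_pos_of_ne_zero hp hp0 hapos
      rw [dotProduct_smul, smul_eq_mul, hpx] at h1
      nlinarith
    obtain ⟨A, hA, hle⟩ : ∃ A ∈ 𝒜, ∀ᵐ t ∂μ.restrict A, u t (f t) ≤ u s x := by
      by_contra hcon
      refine lt_irrefl (u s x) (lt_average_of_ae_lt (M.regular.continuousOn s)
        (M.regular.strictMonoOn s) (M.quasiconcave s hs) M.f_nonneg M.measurable_f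
        M.integrable_f.integrableOn (c := u s x) ?_)
      have : ∀ᵐ t ∂μ.restrict (⋃₀ 𝒜), u s x < u t (f t) := by
        refine M.ae_restrict_sUnion fun A hA => ?_
        by_contra hnot
        exact hcon ⟨A, hA, (M.isAtomFamily.isAtom A hA).ae_mem_of_not_ae
          (W := {t | u t (f t) ≤ u s x}) (measurableSet_le hum measurable_const)
          (by simpa using hnot)⟩
      filter_upwards [this, ae_restrict_mem hT] with t ht htT
      rwa [M.utility_eq s hs t htT _ (M.f_nonneg t)]
    have hatom := M.isAtomFamily.isAtom A hA
    obtain ⟨p, hp, hp0, hsupp, hbal, hpx, hpy⟩ := M.exists_price hs hatom.1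
      (Set.subset_sUnion_of_mem hA) hatom.2.1 (M.measureReal_atom_lt h𝒜 hA) ⟨hx0, hle⟩
    rw [← hx] at hpx
    -- On this atom `f` is no better than `x`, so `A` accepts everything at least as good as `x`. By
    -- `hge` the bundles of almost all large agents are of this kind.
    have hpy' : ∀ y : Fin ℓ → ℝ, 0 ≤ y → u s x ≤ u s y → p ⬝ᵥ a s ≤ p ⬝ᵥ y :=
      fun y hy hxy => hpy y ⟨hy, hle.mono fun _ h => h.trans hxy⟩
    refine ⟨p, hp, hp0, ?_⟩
    have hsmall := ae_optimal_of_supporting M.regular M.measurable_f M.f_nonneg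
      M.integrable_f.integrableOn M.integrable_a.integrableOn
      (ae_restrict_of_ae M.a_pos) hp hp0 hsupp hbal
    have hfa : IntegrableOn (fun t => f t - a t) (⋃₀ 𝒜) μ :=
      (M.integrable_f.sub M.integrable_a).integrableOn
    have hnonneg : 0 ≤ᵐ[μ.restrict (⋃₀ 𝒜)] fun t => p ⬝ᵥ (f t - a t) := by
      filter_upwards [hge, ae_restrict_mem hT] with t ht htT
      rw [M.utility_eq t htT s hs _ (M.f_nonneg t)] at ht
      rw [dotProduct_sub, M.endowment_eq t htT s hs]
      exact sub_nonneg.mpr (hpy' _ (M.f_nonneg t) ht)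
    have hzero : (fun t => p ⬝ᵥ (f t - a t)) =ᵐ[μ.restrict (⋃₀ 𝒜)] 0 := by
      rw [← integral_eq_zero_iff_of_nonneg_ae hnonneg (integrable_dotProduct p hfa),
        ← dotProduct_integral p hfa, M.setIntegral_sUnion hs, dotProduct_smul, dotProduct_sub,
        ← hx, hpx, sub_self, smul_zero]
    have hlarge : ∀ᵐ t ∂μ.restrict (⋃₀ 𝒜), p ⬝ᵥ f t ≤ p ⬝ᵥ a t ∧
        ∀ y : Fin ℓ → ℝ, 0 ≤ y → p ⬝ᵥ y ≤ p ⬝ᵥ a t → u t y ≤ u t (f t) := by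
      filter_upwards [hge, hzero, ae_restrict_mem hT] with t ht hz htT
      have hz' : p ⬝ᵥ f t - p ⬝ᵥ a t = 0 := by rw [← dotProduct_sub]; exact hz
      refine ⟨by linarith, fun y hy hyb => ?_⟩
      by_contra! hlt
      have hpa := dotProduct_pos_of_ne_zero hp hp0 hapos
      rw [M.utility_eq t htT s hs y hy] at hlt
      obtain ⟨r, hr0, hr1, hr⟩ :=
        exists_lt_smul (M.regular.continuousOn s) hy (ht.trans_lt hlt)
      have h1 := hpy' (r • y) (smul_nonneg hr0 hy) hr.le
      rw [dotProduct_smul, smul_eq_mul] at h1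
      rw [M.endowment_eq t htT s hs] at hyb
      nlinarith
    rw [ae_restrict_iff' hT] at hlarge
    rw [ae_restrict_iff' hT.compl] at hsmall
    filter_upwards [hlarge, hsmall] with t h1 h2
    by_cases ht : t ∈ ⋃₀ 𝒜
    · exact h1 ht
    · exact h2 ht
  · have hatomless : ∀ A, ¬ IsMeasureAtom μ A := by
      simpa using M.isAtomFamily.atomless_restrict
    have hmem := fun S (hS : MeasurableSet S) =>
      setIntegral_mem_excess (u := u) (a := a) M.f_nonneg M.integrable_f hS
    obtain ⟨p, hp, hp0, hsupp⟩ := exists_supporting_price (D := {0})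
      (convex_closure_excess (u := u) (f := f) hatomless M.integrable_a) (convex_singleton 0)
      ⟨_, hmem ∅ MeasurableSet.empty⟩ (Set.singleton_nonempty 0) (by
        rintro _ ⟨S, g, hS, hg0, hg, hgu, rfl⟩ d rfl
        rw [add_zero]
        exact M.unblocked S g hS hg0 hg hgu (by simp))
    refine ⟨p, hp, hp0, ae_optimal_of_supporting M.regular M.measurable_f M.f_nonneg
      M.integrable_f M.integrable_a M.a_pos hp hp0 (fun z hz => ?_) ?_⟩
    · simpa using hsupp z hz 0 rfl
    · rw [integral_sub M.integrable_f M.integrable_a, M.balanced, sub_self, dotProduct_zero]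

end UnblockedMarket

end Market

/-! ### Events and conditional expectations -/

section Events

variable {Ω : Type*} [mΩ : MeasurableSpace Ω]

/-- Measurable functions are constant on the cells of the common refinement. -/
lemma eq_of_mem_cell {n : ℕ} {Q : Fin n → Set (Set Ω)}
    (hQ : ∀ i, IsMeasurablePartition (Q i)) (hjoin : joinAlgebra Q Set.univ = mΩ)
    {q : Fin n → Set Ω} (hq : ∀ i, q i ∈ Q i) {ω ω' : Ω} (hω : ∀ i, ω ∈ q i)
    (hω' : ∀ i, ω' ∈ q i) {β : Type*} [MeasurableSpace β] [MeasurableSingletonClass β]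
    {φ : Ω → β} (hφ : Measurable φ) : φ ω' = φ ω := by
  -- The generators are cells and do not separate two points of one cell; this property passes to
  -- the generated σ-algebra.
  have key : ∀ s : Set Ω, MeasurableSet[joinAlgebra Q Set.univ] s → (ω ∈ s ↔ ω' ∈ s) := by
    intro s hs
    induction s, hs using MeasurableSpace.generateFrom_induction with
    | hC c hc _ =>
      obtain ⟨-, r, hr, rfl⟩ := hc
      have hcell : ∀ ω₁, (∀ i, ω₁ ∈ q i) → ω₁ ∈ ⋂ i ∈ Set.univ, r i → ∀ i, r i = q i :=
        fun ω₁ h₁ h₂ i => ((hQ i).1.2 ω₁).unique ⟨hr i (Set.mem_univ i), by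
          simp only [Set.mem_iInter] at h₂; exact h₂ i (Set.mem_univ i)⟩ ⟨hq i, h₁ i⟩
      constructor
      · intro h
        simp only [hcell ω hω h, Set.mem_iInter]
        exact fun i _ => hω' i
      · intro h
        simp only [hcell ω' hω' h, Set.mem_iInter]
        exact fun i _ => hω i
    | empty => simp
    | compl t _ ih => simp [ih]
    | iUnion t _ ih => simp [ih]
  rw [hjoin] at key
  exact (key _ (hφ (measurableSet_singleton (φ ω)))).mp rfl

lemma isCondExp_self (P : Measure Ω) [IsFiniteMeasure P] {u : Ω → ℝ} (hu : Measurable u) :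
    IsCondExp mΩ P u u := by
  -- Utility need not be integrable under the prior, but it is bounded on each of these events,
  -- which cover `Ω`.
  refine ⟨hu, fun _ => rfl, fun k : ℕ => {ω | |u ω| ≤ k}, fun k => ?_, ?_, fun k => ?_⟩
  · exact measurableSet_le hu.abs measurable_const
  · exact Set.eq_univ_of_forall fun ω => Set.mem_iUnion.mpr (exists_nat_ge |u ω|)
  · have hm : MeasurableSet {ω | |u ω| ≤ k} := measurableSet_le hu.abs measurable_const
    have hi : IntegrableOn u {ω | |u ω| ≤ k} P :=
      Measure.integrableOn_of_bounded (M := k) (measure_ne_top _ _) hu.aestronglyMeasurable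
        ((ae_restrict_mem hm).mono fun ω h => h)
    exact ⟨hi, hi, fun _ _ _ => rfl⟩

lemma condExpLT_of_lt (P : Measure Ω) [IsFiniteMeasure P] {u u' : Ω → ℝ} (hu : Measurable u)
    (hu' : Measurable u') {ω : Ω} (h : u ω < u' ω) : CondExpLT mΩ P u u' ω := by
  refine ⟨⟨u, isCondExp_self P hu⟩, ⟨u', isCondExp_self P hu'⟩, ?_⟩
  rintro v v' ⟨-, hv, -⟩ ⟨-, hv', -⟩
  rwa [hv hu, hv' hu']

end Events

/-! ### The fine core -/

/-- There are arbitrarily small sets of small agents that meet all sets of a finite family which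
contain a non-null set of small agents. -/
lemma IsAtomFamily.exists_small_meeting {T : Type*} [MeasurableSpace T] {μ : Measure T}
    [IsFiniteMeasure μ] {𝒜 : Set (Set T)} (h𝒜 : IsAtomFamily μ 𝒜) {ι : Type*} [Fintype ι]
    {V : ι → Set T} (hV : ∀ i, MeasurableSet (V i)) {δ : ℝ} (hδ : 0 < δ) :
    ∃ B, MeasurableSet B ∧ μ B ≤ ENNReal.ofReal δ ∧
      ∀ i, 0 < μ (V i ∩ (⋃₀ 𝒜)ᶜ) → 0 < μ (B ∩ V i) := by
  have hT := h𝒜.measurableSet_sUnion.compl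
  have key : ∀ i, ∃ C ⊆ V i, MeasurableSet C ∧ (0 < μ (V i ∩ (⋃₀ 𝒜)ᶜ) → 0 < μ C) ∧
      μ C ≤ ENNReal.ofReal (δ / (Fintype.card ι + 1)) := by
    intro i
    by_cases hpos : 0 < μ (V i ∩ (⋃₀ 𝒜)ᶜ)
    · rw [← Measure.restrict_apply (hV i)] at hpos
      obtain ⟨C, hCV, hC, hCpos, hClt⟩ := exists_subset_measure_lt h𝒜.atomless_restrict (hV i) hpos
        (by positivity : 0 < δ / (Fintype.card ι + 1))
      rw [measureReal_restrict_apply hC] at hClt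
      rw [Measure.restrict_apply hC] at hCpos
      refine ⟨C ∩ (⋃₀ 𝒜)ᶜ, Set.inter_subset_left.trans hCV, hC.inter hT, fun _ => hCpos, ?_⟩
      rw [← ofReal_measureReal]
      exact ENNReal.ofReal_le_ofReal hClt.le
    · exact ⟨∅, Set.empty_subset _, MeasurableSet.empty, fun h => absurd h hpos, by simp⟩
  choose C hCV hC hCpos hCle using key
  refine ⟨⋃ i, C i, MeasurableSet.iUnion hC, ?_, fun i hi => (hCpos i hi).trans_le
    (measure_mono (Set.subset_inter (Set.subset_iUnion C i) (hCV i)))⟩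
  calc μ (⋃ i, C i) ≤ ∑ i, μ (C i) := measure_iUnion_fintype_le μ C
    _ ≤ ∑ _i : ι, ENNReal.ofReal (δ / (Fintype.card ι + 1)) := Finset.sum_le_sum fun i _ => hCle i
    _ = ENNReal.ofReal (Fintype.card ι * (δ / (Fintype.card ι + 1))) := by
      rw [Finset.sum_const, Finset.card_univ, nsmul_eq_mul,
        ENNReal.ofReal_mul (Nat.cast_nonneg _), ENNReal.ofReal_natCast]
    _ ≤ ENNReal.ofReal δ := by
      refine ENNReal.ofReal_le_ofReal ?_
      rw [mul_div_assoc', div_le_iff₀ (by positivity)]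
      nlinarith

namespace Economy

variable {Ω T : Type*} [mΩ : MeasurableSpace Ω] [MeasurableSpace T] {ℓ : ℕ}
  {E : Economy Ω T ℓ}

lemma regularUtility_state (h₂ : E.A2) (h₃ : E.A3) (ω : Ω) : RegularUtility fun t => E.U t ω :=
  ⟨fun x hx => (h₂ x hx).comp measurable_prodMk_right, fun t => (h₃ t ω).1, fun t => (h₃ t ω).2⟩

lemma regularUtility_agent (h₂ : E.A2) (h₃ : E.A3) (t : T) : RegularUtility (E.U t) :=
  ⟨fun x hx => (h₂ x hx).comp measurable_prodMk_left, fun ω => (h₃ t ω).1, fun ω => (h₃ t ω).2⟩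

/-- A coalition that holds all information can fine block with an improvement in one state. -/
lemma fineBlocked_of_improvement (h₁ : E.A1') (h₂ : E.A2) (h₃ : E.A3) (h₅ : E.A5)
    {f : T → Ω → (Fin ℓ → ℝ)} (hf : E.IsAllocation f) (ω : Ω) {S : Set T} (hS : MeasurableSet S)
    (hpres : E.present S = Set.univ) {g : T → Fin ℓ → ℝ} (hg0 : ∀ t, 0 ≤ g t)
    (hg : Integrable g E.μ) (hbal : ∫ t in S, g t ∂E.μ = ∫ t in S, E.a t ω ∂E.μ)
    (himp : ∀ᵐ t ∂E.μ.restrict S, E.U t ω (f t ω) < E.U t ω (g t)) : E.FineBlocked f S := by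
  classical
  have hex : ∀ i, ∃ q ∈ E.Q i, ω ∈ q := fun i => by
    obtain ⟨q, hq, -⟩ := (E.isMeasurablePartition_Q i).1.2 ω
    exact ⟨q, hq.1, hq.2⟩
  choose q hq hωq using hex
  let Ω₀ : Set Ω := ⋂ i, q i
  have hω₀ : ω ∈ Ω₀ := Set.mem_iInter.mpr hωq
  have hΩ₀ : MeasurableSet Ω₀ :=
    MeasurableSet.iInter fun i => (E.isMeasurablePartition_Q i).2 _ (hq i)
  have ham : ∀ t, Measurable (E.a t) := fun t => h₁.1.comp measurable_prodMk_left
  have hconst : ∀ {φ : Ω → Fin ℓ → ℝ}, Measurable φ → ∀ ω' ∈ Ω₀, φ ω' = φ ω :=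
    fun hφ ω' hω' => eq_of_mem_cell E.isMeasurablePartition_Q h₅.2.2 hq hωq
      (Set.mem_iInter.mp hω') hφ
  let b : T → Fin ℓ → ℝ := S.piecewise g fun t => E.a t ω
  -- Endowments outside the coalition or outside the cell make `g'` feasible in every state.
  let g' : T → Ω → Fin ℓ → ℝ := fun t => Ω₀.piecewise (fun _ => b t) (E.a t)
  have hb0 : ∀ t, 0 ≤ b t := fun t => by
    by_cases ht : t ∈ S <;> simp [b, ht, hg0 t, E.a_nonneg t ω]
  have hb : Integrable b E.μ := Integrable.piecewise hS hg.integrableOn (h₁.2 ω).1.integrableOn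
  have hbS : ∫ t in S, b t ∂E.μ = ∫ t in S, E.a t ω ∂E.μ := by
    rw [← hbal]
    exact setIntegral_congr_fun hS fun t ht => by simp [b, ht]
  have hbT : ∫ t, b t ∂E.μ = ∫ t, E.a t ω ∂E.μ := by
    rw [← integral_add_compl hS hb, ← integral_add_compl hS (h₁.2 ω).1, hbS]
    congr 1
    refine setIntegral_congr_fun hS.compl fun t ht => ?_
    have ht' : t ∉ S := ht
    simp [b, ht']
  have hin : ∀ ω' ∈ Ω₀, ∀ t, g' t ω' = b t := fun ω' h t => Set.piecewise_eq_of_mem _ _ _ h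
  have hout : ∀ ω' ∉ Ω₀, ∀ t, g' t ω' = E.a t ω' :=
    fun ω' h t => Set.piecewise_eq_of_notMem _ _ _ h
  have hain : ∀ ω' ∈ Ω₀, ∀ t, E.a t ω' = E.a t ω := fun ω' h t => hconst (ham t) ω' h
  have hg' : E.IsAllocation g' := by
    refine ⟨⟨fun t ω' => ?_, fun ω' => ?_, fun t => measurable_const.piecewise hΩ₀ (ham t)⟩,
      fun ω' => ?_⟩
    · by_cases h : ω' ∈ Ω₀
      · rw [hin ω' h]; exact hb0 t
      · rw [hout ω' h]; exact E.a_nonneg t ω'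
    · by_cases h : ω' ∈ Ω₀
      · simpa only [hin ω' h] using hb
      · simpa only [hout ω' h] using (h₁.2 ω').1
    · by_cases h : ω' ∈ Ω₀
      · simp only [hin ω' h, hain ω' h, hbT]
      · simp only [hout ω' h]
  -- All members receive the full σ-algebra. Conditional expectations are then the utilities
  -- themselves, even if a prior gives the cell probability zero.
  refine ⟨g', fun _ => mΩ, Ω₀, hg', ⟨⟨fun _ _ => le_rfl, fun ℋ _ => ?_⟩, ?_⟩, ⟨ω, hω₀⟩,
    fun _ _ => hΩ₀, fun ω' hω' => ⟨?_, ?_⟩⟩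
  · by_cases h : mΩ = ℋ <;> simp [h, hS]
  · refine Filter.Eventually.of_forall fun t => ⟨?_, ?_⟩
    · obtain ⟨i, hi⟩ := E.info_mem t
      refine MeasurableSpace.generateFrom_le fun c hc => ?_
      rw [hi] at hc
      exact (E.isMeasurablePartition_Q i).2 c hc
    · rw [hpres]
      exact h₅.2.2.ge
  · simp only [hin ω' hω', hain ω' hω', hbS]
  · filter_upwards [himp, ae_restrict_mem hS] with t ht htS
    have := E.isProbabilityMeasure_prior t
    have hU := regularUtility_agent h₂ h₃ t
    refine condExpLT_of_lt _ (hU.measurable_comp (hf.1.2.2 t) (hf.1.1 t))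
      (hU.measurable_comp (hg'.1.2.2 t) (hg'.1.1 t)) ?_
    have hUconst : ∀ x : Fin ℓ → ℝ, 0 ≤ x → E.U t ω' x = E.U t ω x := fun x hx =>
      eq_of_mem_cell E.isMeasurablePartition_Q h₅.2.2 hq hωq (Set.mem_iInter.mp hω')
        (hU.measurable x hx)
    rw [hin ω' hω', hconst (hf.1.2.2 t) ω' hω', hUconst _ (hf.1.1 t ω), hUconst _ (hb0 t)]
    simpa [b, htS] using ht

/-- In every state, an allocation of the fine core is unblocked in the complete information
economy. -/
lemma unblockedMarket_of_mem_fineCore (hℓ : 0 < ℓ) (h₁ : E.A1') (h₂ : E.A2) (h₃ : E.A3)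
    (h₄ : E.A4') (h₅ : E.A5) (h₆ : E.A6) {f : T → Ω → (Fin ℓ → ℝ)} (hf : f ∈ E.fineCore)
    (ω : Ω) : UnblockedMarket E.μ E.atoms (fun t => E.U t ω) (fun t => f t ω)
      (fun t => E.a t ω) := by
  classical
  have := E.isFiniteMeasure_μ
  have := E.isComplete_μ
  obtain ⟨⟨⟨hf0, hfi, hfm⟩, hfa⟩, hcore⟩ := hf
  have hU := regularUtility_state h₂ h₃ ω
  refine ⟨E.isAtomFamily_atoms, hU,
    (hfi ω).1.aemeasurable.nullMeasurable.measurable_of_complete, fun t => hf0 t ω, hfi ω,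
    (h₁.2 ω).1, (h₁.2 ω).2, hfa ω, fun s hs t ht => (h₆ s hs t ht).2.1 ω,
    fun s hs t ht => congrFun (h₆ s hs t ht).2.2.1 ω, fun t ht => h₄ t ht ω, ?_⟩
  intro S g hS hg0 hg hgu hlarge hneg
  have hai := (h₁.2 ω).1
  choose B hB hBle hBpos using fun k : ℕ => E.isAtomFamily_atoms.exists_small_meeting
    E.measurableSet_info (δ := 1 / ((k : ℝ) + 1)) (by positivity)
  have hBtend : Filter.Tendsto (E.μ ∘ fun k => B k \ S) Filter.atTop (nhds 0) := by
    refine tendsto_of_tendsto_of_tendsto_of_le_of_le tendsto_const_nhds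
      (h := fun k : ℕ => ENNReal.ofReal (1 / ((k : ℝ) + 1))) ?_ (fun _ => zero_le)
      fun k => (measure_mono Set.sdiff_subset).trans (hBle k)
    simpa using ENNReal.tendsto_ofReal (tendsto_one_div_add_atTop_nhds_zero_nat (𝕜 := ℝ))
  -- By absolute continuity of the integral, the net trade of the added agents vanishes in the
  -- limit, so for some `k` the surplus survives.
  have hlim := (((hfi ω).sub hai).tendsto_setIntegral_nhds_zero hBtend).const_add
    (∫ t in S, (g t - E.a t ω) ∂E.μ)
  rw [add_zero] at hlim
  have hopen : IsOpen (Set.univ.pi fun _ : Fin ℓ => Set.Iio (0 : ℝ)) :=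
    isOpen_set_pi Set.finite_univ fun _ _ => isOpen_Iio
  obtain ⟨k, hk⟩ := (hlim.eventually (hopen.mem_nhds fun h _ => hneg h)).exists
  let S' : Set T := S ∪ (B k \ S)
  have hS' : MeasurableSet S' := hS.union ((hB k).diff hS)
  let g' : T → Fin ℓ → ℝ := S.piecewise g fun t => f t ω
  have hg' : Integrable g' E.μ := Integrable.piecewise hS hg.integrableOn (hfi ω).integrableOn
  have hg0' : ∀ t, 0 ≤ g' t := fun t => by
    by_cases ht : t ∈ S <;> simp [g', ht, hg0 t, hf0 t ω]
  have hgu' : ∀ᵐ t ∂E.μ, E.U t ω (f t ω) ≤ E.U t ω (g' t) := by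
    filter_upwards [hgu] with t h
    by_cases ht : t ∈ S <;> simp [g', ht, h]
  have hga' : Integrable (fun t => g' t - E.a t ω) E.μ := hg'.sub hai
  have hint : ∫ t in S', (g' t - E.a t ω) ∂E.μ
      = ∫ t in S, (g t - E.a t ω) ∂E.μ + ∫ t in B k \ S, (f t ω - E.a t ω) ∂E.μ := by
    rw [setIntegral_union Set.disjoint_sdiff_right ((hB k).diff hS) hga'.integrableOn
      hga'.integrableOn]
    congr 1
    · exact setIntegral_congr_fun hS fun t ht => by simp [g', ht]
    · exact setIntegral_congr_fun ((hB k).diff hS) fun t ht => by simp [g', ht.2]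
  have hneg' : ∀ h, (∫ t in S', (g' t - E.a t ω) ∂E.μ) h < 0 := fun h => by
    rw [hint]; exact hk h (Set.mem_univ h)
  have hS'pos : 0 < E.μ S' := by
    rw [pos_iff_ne_zero]
    intro h0
    have := hneg' ⟨0, hℓ⟩
    rw [Measure.restrict_eq_zero.mpr h0, integral_zero_measure] at this
    exact lt_irrefl _ this
  have hm : 0 < E.μ.real S' := ENNReal.toReal_pos hS'pos.ne' (measure_ne_top _ _)
  -- The surplus per unit of mass: handing it out restores exact feasibility and makes weak
  -- improvements strict.
  let σ : Fin ℓ → ℝ := -((E.μ.real S')⁻¹ • ∫ t in S', (g' t - E.a t ω) ∂E.μ)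
  have hσ : ∀ h, 0 < σ h := fun h => by
    simp only [σ, Pi.neg_apply, Pi.smul_apply, smul_eq_mul, neg_pos]
    exact mul_neg_of_pos_of_neg (inv_pos.mpr hm) (hneg' h)
  have hσ0 : 0 < σ := by
    refine lt_of_le_of_ne (fun h => (hσ h).le) fun h0 => ?_
    exact (hσ ⟨0, hℓ⟩).ne (congrFun h0 _)
  have hpres : E.present S' = Set.univ := by
    refine Set.eq_univ_of_forall fun i => ?_
    -- A partition held by one large agent is held by all of them, and `S` contains a non-null set
    -- of them. Any other partition is held by small agents only, and `B k` meets its holders.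
    by_cases hex : ∃ s ∈ ⋃₀ E.atoms, E.info s = E.Q i
    · obtain ⟨s, hs, hsi⟩ := hex
      exact (hlarge ⟨s, hs⟩).trans_le (measure_mono fun t ht =>
        ⟨Or.inl ht.1, (h₆ t ht.2 s hs).1.trans hsi⟩)
    · have hsub : {t | E.info t = E.Q i} ∩ (⋃₀ E.atoms)ᶜ = E.part Set.univ i := by
        ext t
        simp only [part, Set.mem_inter_iff, Set.mem_ofPred_eq, Set.mem_univ, true_and,
          Set.mem_compl_iff, and_iff_left_iff_imp]
        exact fun hti ht => hex ⟨t, ht, hti⟩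
      have hpos := hBpos k i (by rw [hsub]; exact h₅.1 i)
      refine hpos.trans_le (measure_mono fun t ht => ⟨?_, ht.2⟩)
      by_cases htS : t ∈ S
      · exact Or.inl htS
      · exact Or.inr ⟨ht.1, htS⟩
  refine hcore S' ⟨hS', hS'pos⟩ (fineBlocked_of_improvement h₁ h₂ h₃ h₅ ⟨⟨hf0, hfi, hfm⟩, hfa⟩ ω
    hS' hpres (g := fun t => g' t + σ) (fun t => add_nonneg (hg0' t) hσ0.le)
    (hg'.add (integrable_const σ)) ?_ ?_)
  · rw [integral_add hg'.integrableOn (integrable_const σ), setIntegral_const]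
    simp only [σ]
    rw [smul_neg, smul_inv_smul₀ hm.ne', integral_sub hg'.integrableOn hai.integrableOn]
    abel
  · refine ae_restrict_of_ae ?_
    filter_upwards [hgu'] with t ht
    exact ht.trans_lt (hU.strictMonoOn t (Set.mem_Ici.mpr (hg0' t))
      (Set.mem_Ici.mpr (add_nonneg (hg0' t) hσ0.le)) (lt_add_of_pos_right _ hσ0))

end Economy

end MixedEconomy

end

theorem corollary4p3 {Ω T : Type*} [MeasurableSpace Ω] [MeasurableSpace T] {ℓ : ℕ} (hℓ : 0 < ℓ)
    (E : MixedEconomy.Economy Ω T ℓ)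
    (h₁ : E.A1') (h₂ : E.A2) (h₃ : E.A3) (h₄ : E.A4') (h₅ : E.A5) (h₆ : E.A6)
    (h𝒜 : 2 ≤ E.atoms.encard ∨ E.atoms = ∅)
    (f : T → Ω → (Fin ℓ → ℝ)) (hf : f ∈ E.fineCore) (ω : Ω) :
    (fun t => f t ω) ∈ E.walrasianAllocations ω := by
  have := E.isFiniteMeasure_μ
  have M := MixedEconomy.Economy.unblockedMarket_of_mem_fineCore hℓ h₁ h₂ h₃ h₄ h₅ h₆ hf ω
  obtain ⟨p, hp, hp0, hopt⟩ := M.exists_equilibrium_price h𝒜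
  have hsum : 0 < ∑ h, p h := by
    simpa [dotProduct] using
      MixedEconomy.dotProduct_pos_of_ne_zero (x := fun _ => 1) hp hp0 fun _ => one_pos
  have hiff : ∀ x y : Fin ℓ → ℝ, ((∑ h, p h)⁻¹ • p) ⬝ᵥ x ≤ ((∑ h, p h)⁻¹ • p) ⬝ᵥ y ↔
      p ⬝ᵥ x ≤ p ⬝ᵥ y := fun x y => by
    rw [smul_dotProduct, smul_dotProduct, smul_eq_mul, smul_eq_mul,
      mul_le_mul_iff_right₀ (inv_pos.mpr hsum)]
  refine ⟨(∑ h, p h)⁻¹ • p, M.f_nonneg, M.integrable_f, M.balanced, ⟨fun h => ?_, ?_⟩, ?_⟩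
  · exact mul_nonneg (inv_pos.mpr hsum).le (hp h)
  · simp only [Pi.smul_apply, smul_eq_mul]
    rw [← Finset.mul_sum, inv_mul_cancel₀ hsum.ne']
  · filter_upwards [hopt] with t ht
    refine ⟨⟨M.f_nonneg t, (hiff _ _).mpr ht.1⟩, ?_⟩
    rintro y ⟨hy, hyb⟩
    exact ht.2 y hy ((hiff _ _).mp hyb)
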